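/- Let $V=\{1,\dots,n\}$ be a set of $n$ voters and let $G=(V,E)$ be the complete digraph on $V$, $E=\{(j,k): j\neq k\}$ (the liquid democracy setting). A delegation partition $D$ assigns to every voter $v$ either a direct vote in $\{-1,1\}$ or a delegate $D(v)\in V\setminus\{v\}$. It induces $T_D:V\to\{-1,0,1\}$: each voter receives the direct vote reached by following delegations, and $T_D(v)=0$ (abstention) if the delegations starting from $v$ lead to a cycle. Voters act independently; each voter delegates with probability $p_d\in[0,1]$ (with $p_d=0$ if $n=1$), choosing the delegate uniformly among the $n-1$ other voters, and votes directly with probability $1-p_d$, for or against with equal probability; $\mathbb P(D)$ is the resulting probability of $D$. Given positive integer weights $w(v)$ and a quota $q\in[1/2,1]$, the weighted voting game is $W(T)=1$ if $\sum_{T(v)=1}w(v)>q\sum_{T(v)\ne 0}w(v)$, and $W(T)=-1$ otherwise. The LD Penrose–Banzhaf measure of a voter $i$ is $$\mathcal M^{ld}_i(W,G)=\sum_{D}\mathbb P(D)\,\frac{W(T_{D_i^+})-W(T_{D_i^-})}{2},$$ where $D_i^{+}$ (resp. $D_i^{-}$) is $D$ modified so that $i$ votes directly for (resp. against). Theorem.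 The LD Penrose–Banzhaf measure on complete digraphs can be computed in pseudo-polynomial time: there are one program of a random access machine and one polynomial $P$ such that on every input $(n,w,q,p_d,i)$ with $n\ge 1$, $w:V\to\mathbb N_{>0}$, rational $q\in[1/2,1]$, rational $p_d\in[0,1]$ ($p_d=0$ if $n=1$) and $i\in V$, the program halts with the exact value of $\mathcal M^{ld}_i(W,G)$ as output (as a numerator and a nonzero denominator), and its running time, counted in bit costs (logarithmic cost; multiplication and division are charged by the product of the bit lengths of the operands), is at most $P\big(n+\max_v w(v)+\ell(q)+\ell(p_d)\big)$, where $\ell(x)$ is the total number of binary digits of the numerator and denominator of $x$. -/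

import Mathlib

/-! ### Delegations, induced votes and the LD Penrose-Banzhaf measure -/

namespace LiquidDemocracy

variable {V : Type*}

/-- The out-neighbourhood of voter `i`: the voters to whom `i` may delegate. -/
abbrev OutNeighbor (G : Digraph V) (i : V) : Type _ := {j : V // G.Adj i j}

/-- A `G`-delegation partition: every voter `i` either delegates to an out-neighbour `j`
(`Sum.inl j`) or votes directly, for (`Sum.inr true`) or against (`Sum.inr false`). -/
abbrev DelegationPartition (G : Digraph V) : Type _ := (i : V) → OutNeighbor G i ⊕ Bool

/-- `Resolves D b v`: resolving the delegations of `D` assigns to `v` the vote `b`. This is the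
least relation containing the direct votes `b` and closed under following a delegation. -/
inductive Resolves {G : Digraph V} (D : DelegationPartition G) (b : Bool) : V → Prop
  | direct {v : V} (h : D v = Sum.inr b) : Resolves D b v
  | delegate {v : V} {u : OutNeighbor G v} (h : D v = Sum.inl u) (hu : Resolves D b u.1) :
      Resolves D b v

open Classical in
/-- The direct-vote partition induced by a delegation partition: `1` (for), `-1` (against), or `0`
(abstention) for the voters that never receive a vote, i.e. whose delegations end in a cycle. -/
noncomputable def inducedVote {G : Digraph V} (D : DelegationPartition G) (v : V) : SignType :=
  if Resolves D true v then 1 else if Resolves D false v then -1 else 0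

/-- The weighted voting game with weights `w` and quota `q`: the proposal is accepted (`1`) iff
`w(T⁺) > q * w(T⁺ ∪ T⁻)`, and otherwise it is rejected (`-1`). -/
def weightedVotingGame [Fintype V] (w : V → ℕ) (q : ℚ) (T : V → SignType) : ℤ :=
  if q * ((∑ v with T v ≠ 0, w v : ℕ) : ℚ) < ((∑ v with T v = 1, w v : ℕ) : ℚ) then 1 else -1

/-- The number of out-neighbours of a voter. -/
def outDegree [Fintype V] (G : Digraph V) [DecidableRel G.Adj] (i : V) : ℕ :=
  Fintype.card (OutNeighbor G i)

/-- The probability that voter `i` takes a given action, where `pd d` is the probability of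
delegating for a voter with `d` out-neighbours: the out-neighbours are equally likely delegates,
and the two direct votes are equally likely. -/
def actionProb [Fintype V] (G : Digraph V) [DecidableRel G.Adj] (pd : ℕ → ℚ) (i : V) :
    OutNeighbor G i ⊕ Bool → ℚ
  | Sum.inl _ => pd (outDegree G i) / outDegree G i
  | Sum.inr _ => (1 - pd (outDegree G i)) / 2

/-- The probability of a delegation partition; the voters act independently. -/
def partitionProb [Fintype V] (G : Digraph V) [DecidableRel G.Adj] (pd : ℕ → ℚ)
    (D : DelegationPartition G) : ℚ :=
  ∏ i, actionProb G pd i (D i)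

/-- The LD Penrose-Banzhaf measure of voter `i` for the voting rule `W` on the digraph `G`.
`Function.update D i (Sum.inr b)` is `D` modified so that `i` votes directly as told by `b`. -/
noncomputable def ldMeasure [Fintype V] [DecidableEq V] (G : Digraph V) [DecidableRel G.Adj]
    (pd : ℕ → ℚ) (W : (V → SignType) → ℤ) (i : V) : ℚ :=
  ∑ D : DelegationPartition G, partitionProb G pd D *
    (((W (inducedVote (Function.update D i (Sum.inr true))) -
      W (inducedVote (Function.update D i (Sum.inr false))) : ℤ) : ℚ) / 2)

/-- The complete digraph: an arc from every vertex to every other vertex, and no loops. -/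
def completeDigraph (V : Type*) : Digraph V where
  Adj i j := i ≠ j

instance [DecidableEq V] : DecidableRel (completeDigraph V).Adj :=
  fun i j => inferInstanceAs (Decidable (i ≠ j))

end LiquidDemocracy

/-! ### Random access machines with logarithmic cost -/

namespace RAM

/-- A memory state: registers (a program mentions only finitely many of them, by fixed numbers) and
a randomly accessible memory. All contents are natural numbers. -/
structure State where
  reg : ℕ → ℕ
  mem : ℕ → ℕ

/-- Arithmetic expressions; `load e` is the content of the memory cell whose address is the value
of `e`. -/
inductive Expr where
  | const (k : ℕ)
  | reg (r : ℕ)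
  | load (e : Expr)
  | add (e f : Expr)
  | sub (e f : Expr)
  | mul (e f : Expr)
  | div (e f : Expr)

/-- The value of an expression; `sub` is truncated subtraction and `div` is integer division. -/
def Expr.eval (s : State) : Expr → ℕ
  | .const k => k
  | .reg r => s.reg r
  | .load e => s.mem (e.eval s)
  | .add e f => e.eval s + f.eval s
  | .sub e f => e.eval s - f.eval s
  | .mul e f => e.eval s * f.eval s
  | .div e f => e.eval s / f.eval s

/-- The cost of handling the number `x`: one more than its number of binary digits. -/
def numCost (x : ℕ) : ℕ := Nat.size x + 1

/-- The bit cost of evaluating an expression: access to numbers, addition and subtraction are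
charged by the sum of the lengths, multiplication and division by the product of the lengths. -/
def Expr.cost (s : State) : Expr → ℕ
  | .const k => numCost k
  | .reg r => numCost (s.reg r)
  | .load e => e.cost s + numCost (e.eval s) + numCost (s.mem (e.eval s))
  | .add e f => e.cost s + f.cost s + numCost (e.eval s) + numCost (f.eval s)
  | .sub e f => e.cost s + f.cost s + numCost (e.eval s) + numCost (f.eval s)
  | .mul e f => e.cost s + f.cost s + numCost (e.eval s) * numCost (f.eval s)
  | .div e f => e.cost s + f.cost s + numCost (e.eval s) * numCost (f.eval s)

/-- Programs: `set r e` writes the value of `e` to register `r`, `store a e` writes the value of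
`e` to the memory cell whose address is the value of `a`, and tests ask whether a value is
nonzero. -/
inductive Program where
  | skip
  | set (r : ℕ) (e : Expr)
  | store (a e : Expr)
  | seq (p p' : Program)
  | ifNonzero (e : Expr) (p p' : Program)
  | whileNonzero (e : Expr) (p : Program)

/-- `Exec p s s' t`: started in state `s`, the program `p` halts in state `s'`, and the run has
total bit cost `t`. -/
inductive Exec : Program → State → State → ℕ → Prop
  | skip (s : State) : Exec .skip s s 1
  | set (r : ℕ) (e : Expr) (s : State) :
      Exec (.set r e) s { s with reg := Function.update s.reg r (e.eval s) } (e.cost s + 1)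
  | store (a e : Expr) (s : State) :
      Exec (.store a e) s { s with mem := Function.update s.mem (a.eval s) (e.eval s) }
        (a.cost s + e.cost s + 1)
  | seq {p p' : Program} {s s' s'' : State} {t t' : ℕ} (h : Exec p s s' t)
      (h' : Exec p' s' s'' t') : Exec (.seq p p') s s'' (t + t')
  | ifTrue {e : Expr} {p p' : Program} {s s' : State} {t : ℕ} (he : e.eval s ≠ 0)
      (h : Exec p s s' t) : Exec (.ifNonzero e p p') s s' (e.cost s + 1 + t)
  | ifFalse {e : Expr} {p p' : Program} {s s' : State} {t : ℕ} (he : e.eval s = 0)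
      (h : Exec p' s s' t) : Exec (.ifNonzero e p p') s s' (e.cost s + 1 + t)
  | whileDone {e : Expr} {p : Program} {s : State} (he : e.eval s = 0) :
      Exec (.whileNonzero e p) s s (e.cost s + 1)
  | whileStep {e : Expr} {p : Program} {s s' s'' : State} {t t' : ℕ} (he : e.eval s ≠ 0)
      (h : Exec p s s' t) (h' : Exec (.whileNonzero e p) s' s'' t') :
      Exec (.whileNonzero e p) s s'' (e.cost s + 1 + t + t')

end RAM

/-! ### The input of the computational problem -/

namespace LiquidDemocracy

/-- The initial state for the input `(n, w, q, p, i)`: registers `0` to `5` hold `n`, the index of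
the voter `i`, and the numerators and denominators of the nonnegative rationals `q` and `p`; the
first `n` memory cells hold the weights; everything else is `0`. -/
def inputState (n : ℕ) (w : Fin n → ℕ) (q p : ℚ) (i : Fin n) : RAM.State where
  reg r := [n, i.1, q.num.toNat, q.den, p.num.toNat, p.den].getD r 0
  mem a := if h : a < n then w ⟨a, h⟩ else 0

/-- The size parameter of an input: the number of voters plus the maximum weight of a voter (both
by value) plus the binary lengths of the two rational numbers. -/
def inputSize (n : ℕ) (w : Fin n → ℕ) (q p : ℚ) : ℕ :=
  n + Finset.univ.sup w + (Nat.size q.num.toNat + Nat.size q.den) +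
    (Nat.size p.num.toNat + Nat.size p.den)

end LiquidDemocracy

/-!
Fix a voter `i` and resolve all delegations without looking at the action of `i`. Every voter then
has one of four fates: its delegations end in a cycle, at `i`, or at a direct vote for or against by
another voter. The fates determine the outcome of the vote for either vote of `i`, so the measure is
the probability that the fates are such that `i` is decisive (`ldMeasure_completeDigraph`).

On the complete digraph the probability of an assignment of fates depends only on the sizes of the
four classes. Indeed the assignment is the true one iff the lost voters delegate among themselves
and every other class forms a forest hanging from its roots (`prod_fateEvent`). These four events
concern disjoint sets of voters, so they are independent (`expect_prod_fibers`), and the weighted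
number of forests on `m` vertices is `r * (r + m * y) ^ (m - 1)` (`expect_allReach`); this
generalization of Cayley's formula follows by removing the roots and applying the binomial theorem
(`forestWeight_eq_sum`).

It remains to count the assignments of fates with given class sizes and class weights. There are
only polynomially many profiles of this kind when the weights are given in unary. Code a profile as
a number; the sum of `B ^ code` over all assignments is a product over the voters, hence easily
computed, and its digits in base `B` are the required counts if `B` is large (`sum_digit_mul`).
Thus the numerator of the measure is the value of an explicit arithmetical term with bounded sums
and products (`numeratorTerm`), and the denominator is a power.

Finally, such terms can be compiled to programs of the random access machine
(`RAM.Term.compile_computes`). A bounded sum or product is at most as long as all its summands or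
factors together, so the cost is polynomial as soon as the numbers of loop iterations are, which is
checked syntactically (`RAM.Term.feasible`, `RAM.Term.costBound_le_of_feasible`).
-/

/-! ### A language of arithmetical terms and its compilation -/

namespace RAM

/-- The binary operations of `Expr`. -/
inductive BinOp where
  | add
  | sub
  | mul
  | div

def BinOp.toExpr : BinOp → Expr → Expr → Expr
  | .add => .add
  | .sub => .sub
  | .mul => .mul
  | .div => .div

def BinOp.apply : BinOp → ℕ → ℕ → ℕ
  | .add => (· + ·)
  | .sub => (· - ·)
  | .mul => (· * ·)
  | .div => (· / ·)

/-- `o.foldDown g c a` combines the accumulator `a` successively with `g (c - 1)`, ..., `g 0`. The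
indices descend because the loop implementing it uses its counter as the index. -/
def BinOp.foldDown (o : BinOp) (g : ℕ → ℕ) : ℕ → ℕ → ℕ
  | 0, a => a
  | c + 1, a => o.foldDown g c (o.apply a (g c))

theorem BinOp.foldDown_add (g : ℕ → ℕ) (c a : ℕ) :
    BinOp.add.foldDown g c a = a + ∑ k ∈ Finset.range c, g k := by
  induction c generalizing a with
  | zero => simp [foldDown]
  | succ c ih => rw [foldDown, ih, Finset.sum_range_succ]; simp only [apply]; ring

theorem BinOp.foldDown_mul (g : ℕ → ℕ) (c a : ℕ) :
    BinOp.mul.foldDown g c a = a * ∏ k ∈ Finset.range c, g k := by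
  induction c generalizing a with
  | zero => simp [foldDown]
  | succ c ih => rw [foldDown, ih, Finset.prod_range_succ]; simp only [apply]; ring

theorem numCost_mono {a b : ℕ} (h : a ≤ b) : numCost a ≤ numCost b :=
  Nat.add_le_add_right (Nat.size_le_size h) 1

theorem numCost_le_succ (a : ℕ) : numCost a ≤ a + 1 :=
  Nat.add_le_add_right (Nat.size_le.2 Nat.lt_two_pow_self) 1

/-- Each operation yields a number no longer than its two operands together; hence a fold is no
longer than all its ingredients together, whatever the operation is. -/
theorem BinOp.numCost_apply_le (o : BinOp) (a b : ℕ) :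
    numCost (o.apply a b) ≤ numCost a + numCost b := by
  have ha := Nat.lt_size_self a
  have hb := Nat.lt_size_self b
  cases o with
  | sub => exact (numCost_mono (Nat.sub_le a b)).trans (Nat.le_add_right _ _)
  | div => exact (numCost_mono (Nat.div_le_self a b)).trans (Nat.le_add_right _ _)
  | mul =>
    have : Nat.size (a * b) ≤ a.size + b.size := by
      rw [Nat.size_le, pow_add]
      exact Nat.mul_lt_mul'' ha hb
    simp only [apply, numCost]; omega
  | add =>
    have : Nat.size (a + b) ≤ a.size + b.size + 1 := by
      rw [Nat.size_le]
      have h1 : 2 ^ a.size ≤ 2 ^ (a.size + b.size) := Nat.pow_le_pow_right (by simp) (by simp)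
      have h2 : 2 ^ b.size ≤ 2 ^ (a.size + b.size) := Nat.pow_le_pow_right (by simp) (by simp)
      rw [pow_succ]; omega
    simp only [apply, numCost]; omega

theorem BinOp.eval_toExpr (o : BinOp) (s : State) (e f : Expr) :
    (o.toExpr e f).eval s = o.apply (e.eval s) (f.eval s) := by
  cases o <;> rfl

theorem BinOp.cost_toExpr_le (o : BinOp) (s : State) (r r' : ℕ) :
    (o.toExpr (.reg r) (.reg r')).cost s ≤
      2 * (numCost (s.reg r) + numCost (s.reg r')) +
        (numCost (s.reg r) + numCost (s.reg r')) ^ 2 := by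
  cases o <;> simp only [toExpr, Expr.cost, Expr.eval] <;>
    nlinarith [sq_nonneg (numCost (s.reg r)), sq_nonneg (numCost (s.reg r'))]

/-- Arithmetical terms over named variables and a memory. `fold o a x c e` starts with the
constant `a` and combines it, using `o`, with the values of `e` as the variable `x` runs through
the numbers below `c`; sums and products are the cases `o = add` and `o = mul`. -/
inductive Term where
  | const (k : ℕ)
  | var (x : ℕ)
  | load (e : Term)
  | bin (o : BinOp) (e f : Term)
  | fold (o : BinOp) (a x : ℕ) (c e : Term)

namespace Term

/-- The value of a term for the memory `m` and the assignment `env` of the variables. -/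
def eval (m : ℕ → ℕ) : Term → (ℕ → ℕ) → ℕ
  | const k, _ => k
  | var x, env => env x
  | load e, env => m (e.eval m env)
  | bin o e f, env => o.apply (e.eval m env) (f.eval m env)
  | fold o a x c e, env =>
      o.foldDown (fun k => e.eval m (Function.update env x k)) (c.eval m env) a

/-- The program evaluating a term into register `d`, where register `ρ x` holds the variable `x`.
Registers from `d` on are work space. A fold uses register `d` for the accumulator and `d + 1` for
the loop counter, which also holds the bound variable. -/
def compile : Term → (ℕ → ℕ) → ℕ → Program
  | const k, _, d => .set d (.const k)
  | var x, ρ, d => .set d (.reg (ρ x))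
  | load e, ρ, d => .seq (e.compile ρ d) (.set d (.load (.reg d)))
  | bin o e f, ρ, d =>
      .seq (e.compile ρ d) (.seq (f.compile ρ (d + 1)) (.set d (o.toExpr (.reg d) (.reg (d + 1)))))
  | fold o a x c e, ρ, d =>
      .seq (c.compile ρ (d + 1)) (.seq (.set d (.const a))
        (.whileNonzero (.reg (d + 1))
          (.seq (.set (d + 1) (.sub (.reg (d + 1)) (.const 1)))
            (.seq (e.compile (Function.update ρ x (d + 1)) (d + 2))
              (.set d (o.toExpr (.reg d) (.reg (d + 2))))))))

/-- A bound on the bookkeeping cost of one loop iteration, for a counter at most `c` and an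
accumulator and summand of total length at most `A`. -/
def iterCost (c A : ℕ) : ℕ := 3 * numCost c + 2 * A + A ^ 2 + 20

/-- An upper bound for the cost of running the compiled term. -/
def costBound (m : ℕ → ℕ) : Term → (ℕ → ℕ) → ℕ
  | const k, _ => numCost k + 1
  | var x, env => numCost (env x) + 1
  | load e, env =>
      e.costBound m env + 2 * numCost (e.eval m env) + numCost (m (e.eval m env)) + 1
  | bin _ e f, env =>
      e.costBound m env + f.costBound m env + 2 * (numCost (e.eval m env) + numCost (f.eval m env))
        + (numCost (e.eval m env) + numCost (f.eval m env)) ^ 2 + 1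
  | fold _ a x c e, env =>
      c.costBound m env + (numCost a + 1) +
        ((c.eval m env + 1) * iterCost (c.eval m env) (numCost a +
            ∑ k ∈ Finset.range (c.eval m env), e.costBound m (Function.update env x k)) +
          ∑ k ∈ Finset.range (c.eval m env), e.costBound m (Function.update env x k))

theorem numCost_foldDown_le (o : BinOp) (g : ℕ → ℕ) (c a : ℕ) :
    numCost (o.foldDown g c a) ≤ numCost a + ∑ k ∈ Finset.range c, numCost (g k) := by
  induction c generalizing a with
  | zero => simp [BinOp.foldDown]
  | succ c ih =>
    have h1 := ih (o.apply a (g c))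
    have h2 := o.numCost_apply_le a (g c)
    rw [BinOp.foldDown, Finset.sum_range_succ]
    omega

theorem numCost_eval_le (m : ℕ → ℕ) (t : Term) (env : ℕ → ℕ) :
    numCost (t.eval m env) ≤ t.costBound m env := by
  induction t generalizing env with
  | const k => simp [eval, costBound]
  | var x => simp [eval, costBound]
  | load e ih => simp only [eval, costBound]; omega
  | bin o e f ihe ihf =>
    have := o.numCost_apply_le (e.eval m env) (f.eval m env)
    simp only [eval, costBound]
    have := ihe env
    have := ihf env
    omega
  | fold o a x c e ihc ihe =>
    have h1 := numCost_foldDown_le o (fun k => e.eval m (Function.update env x k))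
      (c.eval m env) a
    have h2 : ∑ k ∈ Finset.range (c.eval m env), numCost (e.eval m (Function.update env x k)) ≤
        ∑ k ∈ Finset.range (c.eval m env), e.costBound m (Function.update env x k) :=
      Finset.sum_le_sum fun k _ => ihe _
    simp only [eval, costBound]
    generalize (c.eval m env + 1) * _ = z
    omega

/-- Started in `s`, the program `p` halts within cost `T` with `v` in register `d`, the registers
below `d` and the memory being unchanged. -/
def Computes (p : Program) (d v T : ℕ) (s : State) : Prop :=
  ∃ s' t, Exec p s s' t ∧ t ≤ T ∧ s'.reg d = v ∧ (∀ r < d, s'.reg r = s.reg r) ∧ s'.mem = s.mem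

/-- The loop that implements a fold: if `p` computes `g k` into register `d + 2`, the loop
computes the fold into register `d`. -/
theorem exec_loop {o : BinOp} {p : Program} {d : ℕ} {g K : ℕ → ℕ} {m regs : ℕ → ℕ}
    (hK : ∀ k, numCost (g k) ≤ K k)
    (hp : ∀ k s, s.mem = m → (∀ r < d, s.reg r = regs r) → s.reg (d + 1) = k →
      Computes p (d + 2) (g k) (K k) s) (A C : ℕ) :
    ∀ (c : ℕ) (s : State), s.mem = m → (∀ r < d, s.reg r = regs r) → s.reg (d + 1) = c →
      c ≤ C → numCost (s.reg d) + ∑ k ∈ Finset.range c, K k ≤ A →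
      Computes (.whileNonzero (.reg (d + 1))
          (.seq (.set (d + 1) (.sub (.reg (d + 1)) (.const 1)))
            (.seq p (.set d (o.toExpr (.reg d) (.reg (d + 2)))))))
        d (o.foldDown g c (s.reg d))
        ((c + 1) * iterCost C A + ∑ k ∈ Finset.range c, K k) s := by
  intro c
  induction c with
  | zero =>
    intro s hm hr hc _ _
    refine ⟨s, _, .whileDone hc, ?_, rfl, fun _ _ => rfl, rfl⟩
    simp [Expr.cost, hc, numCost, iterCost]
  | succ c ih =>
    intro s hm hr hc hC hA
    rw [Finset.sum_range_succ] at hA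
    set s1 : State := { s with reg := Function.update s.reg (d + 1) c } with hs1
    have e1 : Exec (.set (d + 1) (.sub (.reg (d + 1)) (.const 1))) s s1
        (2 * numCost (c + 1) + 5) := by
      have h := Exec.set (d + 1) (.sub (.reg (d + 1)) (.const 1)) s
      simp only [Expr.eval, Expr.cost, hc, Nat.add_sub_cancel] at h
      have h1 : numCost 1 = 2 := by simp [numCost]
      rw [h1] at h
      convert h using 1
      ring
    obtain ⟨s2, t2, e2, ht2, hv2, hr2, hm2⟩ := hp c s1 hm
      (fun r h => by simp [hs1, show r ≠ d + 1 by omega, hr r h]) (by simp [hs1])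
    have hd2 : s2.reg d = s.reg d := by
      rw [hr2 d (by omega)]; simp [hs1]
    have hd2' : s2.reg (d + 1) = c := by
      rw [hr2 (d + 1) (by omega)]; simp [hs1]
    have e3 := Exec.set d (o.toExpr (.reg d) (.reg (d + 2))) s2
    have hc3 := o.cost_toExpr_le s2 d (d + 2)
    rw [o.eval_toExpr] at e3
    simp only [Expr.eval] at e3
    rw [hd2, hv2] at e3 hc3
    have hsum := o.numCost_apply_le (s.reg d) (g c)
    obtain ⟨s4, t4, e4, ht4, hv4, hr4, hm4⟩ := ih
      { s2 with reg := Function.update s2.reg d (o.apply (s.reg d) (g c)) } (hm2.trans hm)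
      (fun r h => by
        simp only [Function.update_of_ne (show r ≠ d by omega)]
        rw [hr2 r (by omega)]
        simp [hs1, show r ≠ d + 1 by omega, hr r h])
      (by simp [hd2']) (by omega)
      (by
        have := hK c
        simp only [Function.update_self]
        omega)
    refine ⟨s4, _, .whileStep (by simp [Expr.eval, hc]) (.seq e1 (.seq e2 e3)) e4, ?_, ?_, ?_, ?_⟩
    · have hle : numCost (c + 1) ≤ numCost C := numCost_mono hC
      have hk := hK c
      have hA' : numCost (s.reg d) + numCost (g c) ≤ A := by omega
      have hsq := Nat.pow_le_pow_left hA' 2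
      simp only [Expr.cost, hc]
      rw [Finset.sum_range_succ]
      have hx : (c + 1 + 1) * iterCost C A = (c + 1) * iterCost C A + iterCost C A := by ring
      rw [hx]
      have hi : iterCost C A = 3 * numCost C + 2 * A + A ^ 2 + 20 := rfl
      generalize (c + 1) * iterCost C A = z at *
      omega
    · rw [hv4]; simp [BinOp.foldDown]
    · intro r h
      rw [hr4 r h]
      simp only [Function.update_of_ne (show r ≠ d by omega)]
      rw [hr2 r (by omega)]
      simp [hs1, show r ≠ d + 1 by omega]
    · rw [hm4]; exact hm2

/-- Correctness of the compiler, together with the cost bound. -/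
theorem compile_computes (t : Term) : ∀ (ρ : ℕ → ℕ) (d : ℕ) (s : State) (m env : ℕ → ℕ),
    (∀ x, ρ x < d) → s.mem = m → (∀ x, s.reg (ρ x) = env x) →
    Computes (t.compile ρ d) d (t.eval m env) (t.costBound m env) s := by
  induction t with
  | const k =>
    intro ρ d s m env hρ hm hs
    exact ⟨_, _, .set _ _ _, le_rfl, by simp [Expr.eval, eval],
      fun r h => by simp [Nat.ne_of_lt h], rfl⟩
  | var x =>
    intro ρ d s m env hρ hm hs
    exact ⟨_, _, .set _ _ _, by simp [Expr.cost, costBound, hs], by simp [Expr.eval, eval, hs],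
      fun r h => by simp [Nat.ne_of_lt h], rfl⟩
  | load e ih =>
    intro ρ d s m env hρ hm hs
    obtain ⟨s1, t1, e1, ht1, hv1, hr1, hm1⟩ := ih ρ d s m env hρ hm hs
    refine ⟨_, _, .seq e1 (.set _ _ _), ?_, ?_, ?_, hm1⟩
    · simp only [Expr.cost, Expr.eval, hv1, hm1, hm, costBound]; omega
    · simp [Expr.eval, eval, hv1, hm1, hm]
    · intro r h
      simp [Nat.ne_of_lt h, hr1 r h]
  | bin o e f ihe ihf =>
    intro ρ d s m env hρ hm hs
    obtain ⟨s1, t1, e1, ht1, hv1, hr1, hm1⟩ := ihe ρ d s m env hρ hm hs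
    obtain ⟨s2, t2, e2, ht2, hv2, hr2, hm2⟩ := ihf ρ (d + 1) s1 m env
      (fun x => (hρ x).trans (Nat.lt_succ_self d)) (hm1.trans hm)
      (fun x => by rw [hr1 _ (hρ x), hs])
    have hd2 : s2.reg d = e.eval m env := by rw [hr2 d (Nat.lt_succ_self d), hv1]
    refine ⟨_, _, .seq e1 (.seq e2 (.set _ _ _)), ?_, ?_, ?_, hm2.trans hm1⟩
    · have hc := o.cost_toExpr_le s2 d (d + 1)
      rw [hd2, hv2] at hc
      simp only [costBound]
      omega
    · simp [o.eval_toExpr, Expr.eval, eval, hd2, hv2]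
    · intro r h
      simp [Nat.ne_of_lt h, hr2 r (by omega), hr1 r h]
  | fold o a x c e ihc ihe =>
    intro ρ d s m env hρ hm hs
    obtain ⟨s1, t1, e1, ht1, hv1, hr1, hm1⟩ := ihc ρ (d + 1) s m env
      (fun x => (hρ x).trans (Nat.lt_succ_self d)) hm hs
    have e2 := Exec.set d (.const a) s1
    simp only [Expr.eval, Expr.cost] at e2
    have hloop := exec_loop (o := o) (p := e.compile (Function.update ρ x (d + 1)) (d + 2))
      (d := d) (g := fun k => e.eval m (Function.update env x k))
      (K := fun k => e.costBound m (Function.update env x k)) (m := m) (regs := s.reg)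
      (fun k => numCost_eval_le _ _ _)
      (fun k s hm' hr hk => by
        refine ihe _ _ s m _ ?_ hm' ?_
        · intro z
          by_cases hz : z = x
          · subst hz; simp
          · simp only [Function.update_of_ne hz]; have := hρ z; omega
        · intro z
          by_cases hz : z = x
          · subst hz; simpa using hk
          · simp only [Function.update_of_ne hz]
            rw [hr _ (hρ z), hs])
      (numCost a + ∑ k ∈ Finset.range (c.eval m env), e.costBound m (Function.update env x k))
      (c.eval m env) (c.eval m env)
      { s1 with reg := Function.update s1.reg d a } (hm1.trans hm)
      (fun r h => by simp [Nat.ne_of_lt h, hr1 r (by omega)]) (by simp [hv1]) le_rfl (by simp)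
    obtain ⟨s3, t3, e3, ht3, hv3, hr3, hm3⟩ := hloop
    refine ⟨s3, _, .seq e1 (.seq e2 e3), ?_, ?_, ?_, ?_⟩
    · simp only [costBound]
      omega
    · rw [hv3]; simp [eval]
    · intro r h
      rw [hr3 r h]
      simp [Nat.ne_of_lt h, hr1 r (by omega)]
    · rw [hm3]; exact hm1.trans rfl

/-! ### Syntactic polynomial bounds -/

/-- A syntactic criterion for the values of a term to be polynomially bounded, given that the
variables in `S` and the memory contents are: besides variables from `S`, only sums over short
ranges may be used, and no products over ranges. -/
def small (S : List ℕ) : Term → Bool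
  | const _ => true
  | var x => S.contains x
  | load e => e.small S
  | bin _ e f => e.small S && f.small S
  | fold .add _ x c e => c.small S && e.small (x :: S)
  | fold _ _ _ _ _ => false

/-- A syntactic criterion for polynomial cost: every loop count is `small`. Nothing else is
needed, since the length of a fold is at most the total length of its ingredients. -/
def feasible (S : List ℕ) : Term → Bool
  | const _ => true
  | var _ => true
  | load e => e.feasible S
  | bin _ e f => e.feasible S && f.feasible S
  | fold _ _ x c e => c.small S && c.feasible S && e.feasible (x :: S)

/-- Memory contents are at most `N`, variables in `S` have value at most `B`, and all variables
have length at most `B`. -/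
structure Bounded (S : List ℕ) (N B : ℕ) (m env : ℕ → ℕ) : Prop where
  mem_le : ∀ a, m a ≤ N
  env_le : ∀ x ∈ S, env x ≤ B
  numCost_le : ∀ x, numCost (env x) ≤ B

theorem Bounded.update {S : List ℕ} {N B B' k x : ℕ} {m env : ℕ → ℕ}
    (h : Bounded S N B m env) (hB : B + k + 1 ≤ B') :
    Bounded (x :: S) N B' m (Function.update env x k) where
  mem_le := h.mem_le
  env_le z hz := by
    by_cases hzx : z = x
    · subst hzx; simp; omega
    · have := h.env_le z (by simpa [hzx] using hz)
      simp [hzx]; omega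
  numCost_le z := by
    by_cases hzx : z = x
    · subst hzx
      have := numCost_le_succ k
      simp; omega
    · have := h.numCost_le z
      simp [hzx]; omega

theorem BinOp.apply_le (o : BinOp) (a b : ℕ) : o.apply a b ≤ a + b + a * b := by
  cases o with
  | add => simp [BinOp.apply]
  | sub => simp only [BinOp.apply]; omega
  | mul => simp [BinOp.apply]
  | div => exact (Nat.div_le_self a b).trans (by simp only [add_assoc]; omega)

open Polynomial in
theorem eval_le_of_small (t : Term) : ∀ (S : List ℕ), t.small S = true → ∀ P : ℕ[X],
    ∃ Q : ℕ[X], ∀ (N : ℕ) (m env : ℕ → ℕ), Bounded S N (P.eval N) m env →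
      t.eval m env ≤ Q.eval N := by
  induction t with
  | const k => exact fun S _ P => ⟨C k, fun N m env _ => by simp [eval]⟩
  | var x =>
    intro S hS P
    exact ⟨P, fun N m env h => h.env_le x (by simpa [small] using hS)⟩
  | load e ih => exact fun S _ P => ⟨X, fun N m env h => by simpa [eval] using h.mem_le _⟩
  | bin o e f ihe ihf =>
    intro S hS P
    simp only [small, Bool.and_eq_true] at hS
    obtain ⟨Q, hQ⟩ := ihe S hS.1 P
    obtain ⟨R, hR⟩ := ihf S hS.2 P
    refine ⟨Q + R + Q * R, fun N m env h => (BinOp.apply_le o _ _).trans ?_⟩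
    simp only [eval_add, eval_mul]
    gcongr
    all_goals first | exact hQ N m env h | exact hR N m env h
  | fold o a x c e ihc ihe =>
    intro S hS P
    cases o <;> simp only [small, Bool.and_eq_true, Bool.false_eq_true] at hS
    obtain ⟨Q, hQ⟩ := ihc S hS.1 P
    obtain ⟨R, hR⟩ := ihe (x :: S) hS.2 (P + Q + 1)
    refine ⟨C a + Q * R, fun N m env h => ?_⟩
    have hc := hQ N m env h
    simp only [eval, BinOp.foldDown_add, eval_add, eval_mul, eval_C]
    gcongr
    calc _ ≤ ∑ k ∈ Finset.range (c.eval m env), R.eval N := by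
          refine Finset.sum_le_sum fun k hk => hR N m _ (h.update ?_)
          have := Finset.mem_range.1 hk
          simp only [eval_add, eval_one]
          omega
      _ ≤ _ := by
          simp only [Finset.sum_const, Finset.card_range, smul_eq_mul]
          gcongr

open Polynomial in
theorem costBound_le_of_feasible (t : Term) : ∀ (S : List ℕ), t.feasible S = true → ∀ P : ℕ[X],
    ∃ Q : ℕ[X], ∀ (N : ℕ) (m env : ℕ → ℕ), Bounded S N (P.eval N) m env →
      t.costBound m env ≤ Q.eval N := by
  induction t with
  | const k => exact fun S _ P => ⟨C (numCost k + 1), fun N m env _ => by simp [costBound]⟩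
  | var x =>
    intro S _ P
    exact ⟨P + 1, fun N m env h => by simpa [costBound] using h.numCost_le x⟩
  | load e ih =>
    intro S hS P
    obtain ⟨Q, hQ⟩ := ih S hS P
    refine ⟨3 * Q + X + 2, fun N m env h => ?_⟩
    have h1 := hQ N m env h
    have h2 := numCost_eval_le m e env
    have h3 := numCost_le_succ (m (e.eval m env))
    have h4 := h.mem_le (e.eval m env)
    simp only [costBound, eval_add, eval_mul, eval_X, eval_ofNat]
    omega
  | bin o e f ihe ihf =>
    intro S hS P
    simp only [feasible, Bool.and_eq_true] at hS
    obtain ⟨Q, hQ⟩ := ihe S hS.1 P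
    obtain ⟨R, hR⟩ := ihf S hS.2 P
    refine ⟨Q + R + 2 * (Q + R) + (Q + R) ^ 2 + 1, fun N m env h => ?_⟩
    have h1 := hQ N m env h
    have h2 := hR N m env h
    have h3 := (numCost_eval_le m e env).trans h1
    have h4 := (numCost_eval_le m f env).trans h2
    simp only [costBound, eval_add, eval_mul, eval_pow, eval_ofNat, eval_one]
    gcongr
  | fold o a x c e ihc ihe =>
    intro S hS P
    simp only [feasible, Bool.and_eq_true] at hS
    obtain ⟨Q, hQ⟩ := eval_le_of_small c S hS.1.1 P
    obtain ⟨R, hR⟩ := ihc S hS.1.2 P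
    obtain ⟨T, hT⟩ := ihe (x :: S) hS.2 (P + Q + 1)
    refine ⟨R + (C (numCost a) + 1) + ((Q + 1) * (3 * R + 2 * (C (numCost a) + Q * T) +
      (C (numCost a) + Q * T) ^ 2 + 20) + Q * T), fun N m env h => ?_⟩
    have hc := hQ N m env h
    have hn := hR N m env h
    have hn' := (numCost_eval_le m c env).trans hn
    have hsum : ∑ k ∈ Finset.range (c.eval m env), e.costBound m (Function.update env x k) ≤
        Q.eval N * T.eval N := by
      calc _ ≤ ∑ k ∈ Finset.range (c.eval m env), T.eval N := by
            refine Finset.sum_le_sum fun k hk => hT N m _ (h.update ?_)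
            have := Finset.mem_range.1 hk
            simp only [eval_add, eval_one]
            omega
        _ ≤ _ := by
            simp only [Finset.sum_const, Finset.card_range, smul_eq_mul]
            gcongr
    simp only [costBound, iterCost, eval_add, eval_mul, eval_pow, eval_ofNat, eval_one, eval_C]
    gcongr

end Term

/-! ### The program computing two terms -/

/-- Two feasible terms in the initial register contents (variable `x` is register `x`) can be
evaluated into registers `0` and `1` by one program in polynomial time. Only the first `k`
registers may be nonzero initially, so that the others can serve as work space. -/
theorem exists_program (k : ℕ) (S : List ℕ) (num den : Term)
    (hnum : num.feasible S = true) (hden : den.feasible S = true) :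
    ∃ (prog : Program) (bound : Polynomial ℕ), ∀ (N : ℕ) (s : State),
      (∀ a, s.mem a ≤ N) → (∀ x ∈ S, s.reg x ≤ N) → (∀ x, numCost (s.reg x) ≤ N + 1) →
      (∀ x, k ≤ x → s.reg x = 0) →
      ∃ s' t, Exec prog s s' t ∧ t ≤ bound.eval N ∧
        s'.reg 0 = num.eval s.mem s.reg ∧ s'.reg 1 = den.eval s.mem s.reg := by
  obtain ⟨Q, hQ⟩ := Term.costBound_le_of_feasible num S hnum (.X + 1)
  obtain ⟨R, hR⟩ := Term.costBound_le_of_feasible den S hden (.X + 1)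
  refine ⟨.seq (num.compile (min k) (k + 1)) (.seq (den.compile (min k) (k + 2))
    (.seq (.set 0 (.reg (k + 1))) (.set 1 (.reg (k + 2))))), Q + R + (Q + 1) + (R + 1),
    fun N s hmem hS hsize hzero => ?_⟩
  have hB : Term.Bounded S N ((Polynomial.X + 1 : Polynomial ℕ).eval N) s.mem s.reg :=
    ⟨hmem, fun x hx => by simpa using (hS x hx).trans (Nat.le_succ N), by simpa using hsize⟩
  have hQ' := hQ N s.mem s.reg hB
  have hR' := hR N s.mem s.reg hB
  have hmin : ∀ x, min k x < k + 1 := fun x => Nat.lt_succ_of_le (min_le_left k x)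
  have hreg : ∀ x, s.reg (min k x) = s.reg x := fun x => by
    rcases le_total k x with h | h
    · rw [min_eq_left h, hzero k le_rfl, hzero x h]
    · rw [min_eq_right h]
  obtain ⟨s1, t1, e1, ht1, hv1, hr1, hm1⟩ :=
    num.compile_computes (min k) (k + 1) s s.mem s.reg hmin rfl hreg
  obtain ⟨s2, t2, e2, ht2, hv2, hr2, hm2⟩ :=
    den.compile_computes (min k) (k + 2) s1 s.mem s.reg (fun x => (hmin x).trans (by omega)) hm1
      (fun x => by rw [hr1 _ (hmin x), hreg])
  have hk : s2.reg (k + 1) = num.eval s.mem s.reg := by rw [hr2 _ (by omega), hv1]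
  refine ⟨_, _, .seq e1 (.seq e2 (.seq (.set _ _ _) (.set _ _ _))), ?_, ?_, ?_⟩
  · have h1 := Term.numCost_eval_le s.mem num s.reg
    have h2 := Term.numCost_eval_le s.mem den s.reg
    simp [Expr.cost, hk, hv2]
    omega
  · simp [Expr.eval, hk]
  · simp [Expr.eval, hv2]

end RAM

namespace LiquidDemocracy

/-! ### Expectations over independent choices -/

section Independence

variable {V α : Type*} [Fintype V] [DecidableEq V] [Fintype α]

/-- The expectation of `φ` over functions `f : V → α` whose values are chosen independently,
`f v = a` with weight `ω v a`. -/
def expect (ω : V → α → ℚ) (φ : (V → α) → ℚ) : ℚ := ∑ f, (∏ v, ω v (f v)) * φ f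

theorem expect_prod (ω φ : V → α → ℚ) :
    expect ω (fun f => ∏ v, φ v (f v)) = ∏ v, ∑ a, ω v a * φ v a := by
  simp only [expect, ← Finset.prod_mul_distrib]
  exact (Fintype.prod_sum fun v a => ω v a * φ v a).symm

theorem expect_one {ω : V → α → ℚ} (hω : ∀ v, ∑ a, ω v a = 1) : expect ω (fun _ => 1) = 1 := by
  simpa [hω] using expect_prod ω (fun _ _ => 1)

theorem expect_finset_prod {ω : V → α → ℚ} (hω : ∀ v, ∑ a, ω v a = 1) (U : Finset V)
    (φ : V → α → ℚ) : expect ω (fun f => ∏ v ∈ U, φ v (f v)) = ∏ v ∈ U, ∑ a, ω v a * φ v a := by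
  have h := expect_prod ω (fun v a => if v ∈ U then φ v a else 1)
  simp only [Finset.prod_ite_mem, Finset.univ_inter] at h
  rw [h, ← Finset.prod_subset (Finset.subset_univ U)]
  · exact Finset.prod_congr rfl fun v hv => by simp [hv]
  · intro v _ hv
    simp [hv, hω]

theorem expect_sum {ι : Type*} (ω : V → α → ℚ) (s : Finset ι) (φ : ι → (V → α) → ℚ) :
    expect ω (fun f => ∑ k ∈ s, φ k f) = ∑ k ∈ s, expect ω (φ k) := by
  simp only [expect, Finset.mul_sum]
  exact Finset.sum_comm

/-- Functions of disjoint sets of coordinates are independent. The two sides are sums over pairs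
`(f, g)`, with `φ f * ψ f` and with `φ f * ψ g`; exchanging the coordinates outside `U` between
`f` and `g` turns one into the other. -/
theorem expect_mul {ω : V → α → ℚ} (hω : ∀ v, ∑ a, ω v a = 1) (U : Finset V)
    {φ ψ : (V → α) → ℚ} (hφ : DependsOn φ (U : Set V)) (hψ : DependsOn ψ ((U : Set V)ᶜ)) :
    expect ω (fun f => φ f * ψ f) = expect ω φ * expect ω ψ := by
  have key : expect ω (fun f => φ f * ψ f) * expect ω (fun _ => 1) = expect ω φ * expect ω ψ := by
    let swap : (V → α) × (V → α) → (V → α) × (V → α) :=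
      fun x => (U.piecewise x.1 x.2, U.piecewise x.2 x.1)
    have hswap : Function.Involutive swap := by
      rintro ⟨f, g⟩
      refine Prod.ext (funext fun v => ?_) (funext fun v => ?_) <;>
        by_cases hv : v ∈ U <;> simp [swap, hv]
    simp only [expect, Finset.sum_mul_sum, ← Fintype.sum_prod_type']
    rw [← Equiv.sum_comp hswap.toPerm]
    refine Fintype.sum_congr _ _ fun ⟨f, g⟩ => ?_
    have h1 : φ (U.piecewise f g) = φ f := hφ fun v hv => by simp [Finset.mem_coe.1 hv]
    have h2 : ψ (U.piecewise f g) = ψ g := hψ fun v hv => by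
      have : v ∉ U := fun h => hv h
      simp [this]
    have h3 : (∏ v, ω v (U.piecewise f g v)) * ∏ v, ω v (U.piecewise g f v) =
        (∏ v, ω v (f v)) * ∏ v, ω v (g v) := by
      rw [← Finset.prod_mul_distrib, ← Finset.prod_mul_distrib]
      refine Finset.prod_congr rfl fun v _ => ?_
      by_cases hv : v ∈ U <;> simp [hv, mul_comm]
    simp only [Function.Involutive.coe_toPerm, swap, h1, h2]
    linear_combination φ f * ψ g * h3
  rwa [expect_one hω, mul_one] at key

/-- Functions that depend on different fibres of a map `c` are independent. -/
theorem expect_prod_fibers {κ : Type*} [DecidableEq κ] {ω : V → α → ℚ}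
    (hω : ∀ v, ∑ a, ω v a = 1) (c : V → κ) (φ : κ → (V → α) → ℚ)
    (hφ : ∀ k, DependsOn (φ k) {v | c v = k}) (K : Finset κ) :
    expect ω (fun f => ∏ k ∈ K, φ k f) = ∏ k ∈ K, expect ω (φ k) := by
  induction K using Finset.induction_on with
  | empty => simpa using expect_one hω
  | insert k K hk ih =>
    simp only [Finset.prod_insert hk]
    rw [← ih]
    -- Split the coordinates into the fibre over `k` and the rest.
    refine expect_mul hω (Finset.univ.filter fun v => c v = k) ?_ ?_
    · simpa using hφ k
    · intro f g hfg
      refine Finset.prod_congr rfl fun l hl => hφ l fun v hv => hfg v ?_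
      have : c v = l := hv
      have hkl : l ≠ k := fun h => hk (h ▸ hl)
      simp [this, hkl]

end Independence

/-! ### Weighted counts of rooted forests -/

/-- The total weight of the forests on `m` labelled vertices, where a root has weight `r` and
every other vertex has weight `y`. For `m > 0` this is `r * (r + m * y) ^ (m - 1)`; the present
form also gives the right value `1` for `m = 0`. -/
def forestWeight (r y : ℚ) (m : ℕ) : ℚ :=
  (r + m * y) ^ m - m * y * (r + m * y) ^ (m - 1)

theorem forestWeight_zero (r y : ℚ) : forestWeight r y 0 = 1 := by simp [forestWeight]

theorem forestWeight_zero_left (y : ℚ) {m : ℕ} (hm : m ≠ 0) : forestWeight 0 y m = 0 := by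
  obtain ⟨m, rfl⟩ := Nat.exists_eq_succ_of_ne_zero hm
  simp [forestWeight, pow_succ]
  ring

/-- Decomposition of a forest according to the number `k` of its roots: the remaining `m - k`
vertices form a forest whose roots have `k` possible parents. -/
theorem forestWeight_eq_sum (r y : ℚ) (m : ℕ) :
    forestWeight r y m =
      ∑ k ∈ Finset.range (m + 1), (m.choose k : ℚ) * (r ^ k * forestWeight (k * y) y (m - k)) := by
  have h1 : ∀ k ∈ Finset.range (m + 1),
      (m.choose k : ℚ) * (r ^ k * forestWeight (k * y) y (m - k)) =
        r ^ k * (m * y) ^ (m - k) * m.choose k -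
          (m.choose k : ℚ) * ((m - k : ℕ) : ℚ) * (r ^ k * y * (m * y) ^ (m - k - 1)) := by
    intro k hk
    have hk' : k ≤ m := Nat.lt_succ_iff.1 (Finset.mem_range.1 hk)
    have : (k : ℚ) * y + ((m - k : ℕ) : ℚ) * y = m * y := by
      rw [Nat.cast_sub hk']; ring
    rw [forestWeight, this]
    ring
  rw [Finset.sum_congr rfl h1, Finset.sum_sub_distrib, ← add_pow, forestWeight]
  congr 1
  cases m with
  | zero => simp
  | succ m =>
    rw [Finset.sum_range_succ]
    simp only [Nat.sub_self, Nat.cast_zero, mul_zero, zero_mul, add_zero, Nat.add_sub_cancel]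
    rw [add_pow, Finset.mul_sum]
    refine Finset.sum_congr rfl fun k hk => ?_
    have hk' : k ≤ m := Nat.lt_succ_iff.1 (Finset.mem_range.1 hk)
    have h2 : ((m + 1).choose k : ℚ) * ((m + 1 - k : ℕ) : ℚ) = (m.choose k : ℚ) * (m + 1 : ℕ) := by
      exact_mod_cast (Nat.choose_mul_succ_eq m k).symm
    rw [h2, show m + 1 - k - 1 = m - k by omega]
    ring

theorem forestWeight_mul_pow (r y d : ℚ) (m : ℕ) :
    forestWeight r y m * d ^ m = forestWeight (r * d) (y * d) m := by
  cases m with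
  | zero => simp [forestWeight]
  | succ m =>
    simp only [forestWeight, Nat.add_sub_cancel]
    rw [show r * d + ((m + 1 : ℕ) : ℚ) * (y * d) = (r + (m + 1 : ℕ) * y) * d by ring,
      mul_pow, mul_pow]
    ring

/-! ### Reaching a set of roots -/

section Reach

variable {V : Type*}

/-- Following `f` from `v`, one stays in `U` until a value in `R` is reached. -/
inductive ReachIn (f : V → V ⊕ Bool) (U : Finset V) (R : Finset (V ⊕ Bool)) : V → Prop
  | base {v : V} (hv : v ∈ U) (h : f v ∈ R) : ReachIn f U R v
  | step {v u : V} (hv : v ∈ U) (h : f v = Sum.inl u) (hu : ReachIn f U R u) : ReachIn f U R v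

theorem ReachIn.mem {f : V → V ⊕ Bool} {U : Finset V} {R : Finset (V ⊕ Bool)} {v : V}
    (h : ReachIn f U R v) : v ∈ U := by
  cases h <;> assumption

theorem ReachIn.congr {f g : V → V ⊕ Bool} {U : Finset V} {R : Finset (V ⊕ Bool)} {v : V}
    (hfg : ∀ u ∈ U, f u = g u) (h : ReachIn f U R v) : ReachIn g U R v := by
  induction h with
  | base hv h => exact .base hv (hfg _ hv ▸ h)
  | step hv h _ ih => exact .step hv (hfg _ hv ▸ h) ih

theorem not_reachIn_empty (f : V → V ⊕ Bool) (U : Finset V) (v : V) : ¬ ReachIn f U ∅ v := by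
  intro h
  induction h with
  | base _ h => simp at h
  | step _ _ _ ih => exact ih

open Classical in
/-- The indicator of the event that every vertex of `U` reaches `R` inside `U`. -/
noncomputable def allReach (U : Finset V) (R : Finset (V ⊕ Bool)) (f : V → V ⊕ Bool) : ℚ :=
  if ∀ v ∈ U, ReachIn f U R v then 1 else 0

theorem allReach_dependsOn (U : Finset V) (R : Finset (V ⊕ Bool)) :
    DependsOn (allReach U R) (U : Set V) := by
  intro f g hfg
  have h : (∀ v ∈ U, ReachIn f U R v) ↔ ∀ v ∈ U, ReachIn g U R v :=
    forall₂_congr fun v _ => ⟨.congr hfg, .congr fun u hu => (hfg u hu).symm⟩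
  classical exact if_congr h rfl rfl

variable [DecidableEq V]

/-- Peeling off the first layer: all of `U` reaches `R` iff all vertices of `U` that are not
directly attached to `R` reach the ones that are. -/
theorem forall_reachIn_iff (f : V → V ⊕ Bool) (U : Finset V) (R : Finset (V ⊕ Bool)) :
    (∀ v ∈ U, ReachIn f U R v) ↔ ∀ v ∈ U \ U.filter (fun v => f v ∈ R),
      ReachIn f (U \ U.filter fun v => f v ∈ R) ((U.filter fun v => f v ∈ R).image Sum.inl) v := by
  constructor
  · intro h v hv
    have hr := h v (Finset.mem_sdiff.1 hv).1
    induction hr with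
    | base hvU hf => simp [hvU, hf] at hv
    | @step v u hvU hf hu ih =>
      by_cases hR : f u ∈ R
      · exact .base hv (by simp [hf, hu.mem, hR])
      · exact .step hv hf (ih (by simp [hu.mem, hR]))
  · intro h v hv
    by_cases hR : f v ∈ R
    · exact .base hv hR
    · have hr := h v (by simp [hv, hR])
      clear hv hR
      induction hr with
      | base hvU hf =>
        obtain ⟨u, hu, huv⟩ := Finset.mem_image.1 hf
        obtain ⟨huU, huR⟩ := Finset.mem_filter.1 hu
        exact .step (Finset.mem_sdiff.1 hvU).1 huv.symm (.base huU huR)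
      | step hvU hf _ ih => exact .step (Finset.mem_sdiff.1 hvU).1 hf ih

theorem ReachIn.apply_mem {f : V → V ⊕ Bool} {U : Finset V} {R : Finset (V ⊕ Bool)} {v : V}
    (h : ReachIn f U R v) : f v ∈ R ∪ U.image Sum.inl := by
  cases h with
  | base _ h => simp [h]
  | step _ h hu => simp [h, hu.mem]

/-- The event that `U` reaches `R`, split according to the set `L` of the vertices directly
attached to `R`; disjointness makes the cases exclusive. -/
theorem allReach_eq_sum {U : Finset V} {R : Finset (V ⊕ Bool)}
    (hR : Disjoint R (U.image Sum.inl)) (f : V → V ⊕ Bool) :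
    allReach U R f = ∑ L ∈ U.powerset,
      (∏ v ∈ L, if f v ∈ R then 1 else 0) * allReach (U \ L) (L.image Sum.inl) f := by
  rw [Finset.sum_eq_single (U.filter fun v => f v ∈ R)]
  · rw [Finset.prod_eq_one fun v hv => if_pos (Finset.mem_filter.1 hv).2, one_mul]
    classical exact if_congr (forall_reachIn_iff f U R) rfl rfl
  · intro L hL hne
    by_cases h1 : ∀ v ∈ L, f v ∈ R
    · by_cases h2 : ∀ v ∈ U \ L, ReachIn f (U \ L) (L.image Sum.inl) v
      · refine absurd (Finset.Subset.antisymm (fun v hv => ?_) fun v hv => ?_) hne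
        · exact Finset.mem_filter.2 ⟨Finset.mem_powerset.1 hL hv, h1 v hv⟩
        · obtain ⟨hvU, hvR⟩ := Finset.mem_filter.1 hv
          by_contra hvL
          have := (h2 v (by simp [hvU, hvL])).apply_mem
          refine Finset.disjoint_left.1 hR hvR ?_
          refine Finset.union_subset (Finset.image_subset_image (Finset.mem_powerset.1 hL))
            (Finset.image_subset_image Finset.sdiff_subset) this
      · rw [allReach, if_neg h2, mul_zero]
    · push Not at h1
      obtain ⟨v, hv, hvR⟩ := h1
      rw [Finset.prod_eq_zero hv (if_neg hvR), zero_mul]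
  · intro h
    exact absurd (Finset.mem_powerset.2 (Finset.filter_subset _ _)) h

/-- The weight of an action of voter `v`: `x` for either direct vote, `y` for a delegation to
another voter, and `0` for the spurious delegation to `v` itself. -/
def actionWeight (x y : ℚ) (v : V) : V ⊕ Bool → ℚ :=
  Sum.elim (fun u => if u = v then 0 else y) fun _ => x

variable [Fintype V]

theorem sum_actionWeight {x y : ℚ} (h : ((Fintype.card V - 1 : ℕ) : ℚ) * y + 2 * x = 1) (v : V) :
    ∑ a, actionWeight x y v a = 1 := by
  rw [Fintype.sum_sum_type, ← h]
  simp only [actionWeight, Sum.elim_inl, Sum.elim_inr, Fintype.sum_bool]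
  rw [← Finset.sum_erase_add _ _ (Finset.mem_univ v),
    Finset.sum_congr rfl fun u hu => if_neg (Finset.ne_of_mem_erase hu)]
  simp [two_mul]

/-- If each vertex of `U` is attached to `R` with total weight `r`, then `U` reaches `R` with
probability `forestWeight r y`. Induction on the size of `U`, by peeling off the first layer. -/
theorem expect_allReach {x y : ℚ} (h : ((Fintype.card V - 1 : ℕ) : ℚ) * y + 2 * x = 1) :
    ∀ (m : ℕ) (U : Finset V) (R : Finset (V ⊕ Bool)) (r : ℚ), U.card = m →
      Disjoint R (U.image Sum.inl) → (∀ v ∈ U, ∑ a ∈ R, actionWeight x y v a = r) →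
      expect (actionWeight x y) (allReach U R) = forestWeight r y m := by
  intro m
  induction m using Nat.strong_induction_on with
  | _ m ih =>
    intro U R r hU hdisj hr
    have hω := sum_actionWeight (V := V) h
    have hL : ∀ L ∈ U.powerset,
        expect (actionWeight x y) (fun f => (∏ v ∈ L, if f v ∈ R then 1 else 0) *
          allReach (U \ L) (L.image Sum.inl) f) =
        r ^ L.card * forestWeight (L.card * y) y (m - L.card) := by
      intro L hL
      have hLU := Finset.mem_powerset.1 hL
      rw [expect_mul hω L (φ := fun f => ∏ v ∈ L, if f v ∈ R then 1 else 0)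
        (ψ := allReach (U \ L) (L.image Sum.inl))
        (fun f g hfg => Finset.prod_congr rfl fun v hv => by rw [hfg v hv])
        (fun f g hfg => allReach_dependsOn _ _ fun v hv => hfg v (by
          simp only [Finset.coe_sdiff, Set.mem_sdiff, Finset.mem_coe] at hv
          simpa using hv.2))]
      rw [expect_finset_prod hω L (fun _ a => if a ∈ R then 1 else 0),
        Finset.prod_congr rfl fun v hv => show _ = r by simpa using hr v (hLU hv),
        Finset.prod_const]
      congr 1
      have hcard : (U \ L).card = m - L.card := by rw [Finset.card_sdiff_of_subset hLU, hU]
      rcases L.eq_empty_or_nonempty with rfl | hne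
      · rcases U.eq_empty_or_nonempty with rfl | hUne
        · have : m = 0 := by simpa using hU.symm
          subst this
          rw [Finset.card_empty, forestWeight_zero]
          refine Eq.trans ?_ (expect_one hω)
          congr 1
        -- With no vertex attached to the roots nothing can be reached,
        -- and `forestWeight 0 y m` vanishes.
        · obtain ⟨v, hv⟩ := hUne
          have hm : m ≠ 0 := by rw [← hU]; exact Finset.card_ne_zero_of_mem hv
          have : allReach (U \ ∅) ((∅ : Finset V).image Sum.inl) = fun _ => 0 := by
            funext f
            refine if_neg fun hf => not_reachIn_empty f (U \ ∅) v ?_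
            simpa using hf v (by simpa using hv)
          rw [this]
          simp [expect, forestWeight_zero_left y hm]
      · have hpos := hne.card_pos
        have hle := Finset.card_le_card hLU
        refine ih _ (by omega) _ _ _ hcard ?_ ?_
        · rw [Finset.disjoint_image Sum.inl_injective]
          exact Finset.disjoint_sdiff
        · intro v hv
          rw [Finset.sum_image Sum.inl_injective.injOn]
          simp only [actionWeight, Sum.elim_inl]
          have hne' : ∀ u ∈ L, u ≠ v := fun u hu huv => (Finset.mem_sdiff.1 hv).2 (huv ▸ hu)
          rw [Finset.sum_congr rfl fun u hu => if_neg (hne' u hu)]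
          simp
    rw [show allReach U R = fun f => _ from funext fun f => allReach_eq_sum hdisj f,
      expect_sum, Finset.sum_congr rfl hL,
      Finset.sum_powerset_apply_card (fun k => r ^ k * forestWeight (k * y) y (m - k)), hU,
      forestWeight_eq_sum]
    simp [nsmul_eq_mul]

end Reach

end LiquidDemocracy

namespace LiquidDemocracy

/-! ### Fates of the voters -/

theorem resolves_iff_of_direct {V : Type*} {G : Digraph V} {D : DelegationPartition G} {v : V}
    {a : Bool} (h : D v = Sum.inr a) (b : Bool) : Resolves D b v ↔ b = a := by
  constructor
  · rintro (h' | ⟨h', _⟩) <;> simp_all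
  · rintro rfl
    exact .direct h

theorem resolves_iff_of_delegate {V : Type*} {G : Digraph V} {D : DelegationPartition G} {v : V}
    {u : OutNeighbor G v} (h : D v = Sum.inl u) (b : Bool) :
    Resolves D b v ↔ Resolves D b u.1 := by
  constructor
  · rintro (h' | ⟨h', hu⟩)
    · simp_all
    · rw [h] at h'
      rwa [Sum.inl.inj h']
  · exact .delegate h

theorem Resolves.unique {V : Type*} {G : Digraph V} {D : DelegationPartition G} {v : V}
    {a b : Bool} (ha : Resolves D a v) (hb : Resolves D b v) : a = b := by
  induction ha with
  | direct h => exact ((resolves_iff_of_direct h b).1 hb).symm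
  | delegate h _ ih => exact ih ((resolves_iff_of_delegate h b).1 hb)

/-- What becomes of a voter when the delegations are resolved without looking at the action of a
fixed voter `i`: it ends in a cycle (`lost`), it ends at `i` (`follow`), or it ends at a direct
vote of another voter (`vote b`). -/
inductive Fate where
  | lost
  | follow
  | vote (b : Bool)
  deriving DecidableEq, Fintype

theorem Fate.prod_univ {M : Type*} [CommMonoid M] (g : Fate → M) :
    ∏ k, g k = g .lost * g .follow * g (.vote true) * g (.vote false) := by
  have : (Finset.univ : Finset Fate) = {.lost, .follow, .vote true, .vote false} := by decide
  rw [this]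
  simp [mul_assoc]

theorem Fate.sum_univ {M : Type*} [AddCommMonoid M] (g : Fate → M) :
    ∑ k, g k = g .lost + g .follow + g (.vote true) + g (.vote false) := by
  have : (Finset.univ : Finset Fate) = {.lost, .follow, .vote true, .vote false} := by decide
  rw [this]
  simp [add_assoc]

/-- A direct vote as a sign: for is `1` and against is `-1`. -/
def signOf : Bool → SignType
  | true => 1
  | false => -1

/-- The vote received by a voter of the given fate if `i` votes `b`; `b` stands as a default value
in the case of `lost`. -/
def Fate.ballot (b : Bool) : Fate → Bool
  | vote c => c
  | _ => b

/-- The induced vote of a voter of the given fate if `i` votes `b`. -/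
def Fate.sign (b : Bool) : Fate → SignType
  | lost => 0
  | follow => signOf b
  | vote c => signOf c

theorem inducedVote_eq_signOf {V : Type*} {G : Digraph V} {D : DelegationPartition G} {v : V}
    {b : Bool} (h : Resolves D b v) : inducedVote D v = signOf b := by
  cases b with
  | true => exact if_pos h
  | false =>
    have : ¬ Resolves D true v := fun h' => by simpa using h'.unique h
    rw [inducedVote, if_neg this, if_pos h, signOf]

section Weights

variable {V : Type*} [Fintype V]

/-- The total weight of the voters of fate `k`. -/
def fateWeight (w : V → ℕ) (κ : V → Fate) (k : Fate) : ℕ := ∑ v with κ v = k, w v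

theorem sum_fate_filter (w : V → ℕ) (κ : V → Fate) (p : Fate → Prop) [DecidablePred p] :
    ∑ v with p (κ v), w v = ∑ k with p k, fateWeight w κ k := by
  simp only [fateWeight]
  rw [← Finset.sum_fiberwise_of_maps_to (g := κ) (t := Finset.univ.filter p)
    (fun v hv => by simpa using hv)]
  refine Finset.sum_congr rfl fun k hk => Finset.sum_congr ?_ fun _ _ => rfl
  ext v
  simp only [Finset.mem_filter, Finset.mem_univ, true_and] at hk ⊢
  constructor
  · exact fun h => h.2
  · exact fun h => ⟨h ▸ hk, h⟩

end Weights

section Fates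

variable {V : Type*} [DecidableEq V] {G : Digraph V} (D : DelegationPartition G) (i : V)

/-- The actions of a delegation partition as a non-dependent function. -/
def action (v : V) : V ⊕ Bool := Sum.map Subtype.val id (D v)

/-- The partition `D`, modified so that `i` votes `b`. -/
abbrev withVote (b : Bool) : DelegationPartition G := Function.update D i (Sum.inr b)

open Classical in
/-- The fate of `v`, read off from the votes that `v` receives when `i` votes for and when `i`
votes against. Voter `i` itself has fate `follow`. -/
noncomputable def fate (v : V) : Fate :=
  if Resolves (withVote D i true) true v then
    if Resolves (withVote D i false) true v then .vote true else .follow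
  else if Resolves (withVote D i true) false v then .vote false else .lost

theorem fate_self : fate D i i = .follow := by
  have h : ∀ b, withVote D i b i = Sum.inr b := fun b => Function.update_self _ _ _
  simp [fate, resolves_iff_of_direct (h _)]

variable {i} {v : V} (hv : v ≠ i)
include hv

theorem withVote_apply (b : Bool) : withVote D i b v = D v := Function.update_of_ne hv _ _

variable {D}

theorem fate_of_direct {a : Bool} (h : action D v = Sum.inr a) : fate D i v = .vote a := by
  have hD : D v = Sum.inr a := by
    rw [action] at h
    rcases hx : D v with u | b <;> simp_all
  have h' : ∀ b, withVote D i b v = Sum.inr a := fun b => (withVote_apply D hv b).trans hD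
  cases a <;> simp [fate, resolves_iff_of_direct (h' _)]

theorem exists_of_action_eq_inl {u : V} (h : action D v = Sum.inl u) :
    ∃ hu : G.Adj v u, ∀ b, withVote D i b v = Sum.inl ⟨u, hu⟩ := by
  rw [action] at h
  rcases hx : D v with ⟨u', hu'⟩ | b
  · rw [hx] at h
    obtain rfl : u' = u := by simpa using h
    exact ⟨hu', fun b => (withVote_apply D hv b).trans hx⟩
  · simp [hx] at h

theorem fate_of_delegate {u : V} (h : action D v = Sum.inl u) : fate D i v = fate D i u := by
  obtain ⟨hu, h'⟩ := exists_of_action_eq_inl (i := i) hv h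
  have key : ∀ b c, Resolves (withVote D i b) c v ↔ Resolves (withVote D i b) c u :=
    fun b c => resolves_iff_of_delegate (h' b) c
  classical exact if_congr (key _ _) (if_congr (key _ _) rfl rfl) (if_congr (key _ _) rfl rfl)

omit hv

/-- The actions by which a voter is directly attached to the given fate. -/
def Fate.roots (i : V) : Fate → Finset (V ⊕ Bool)
  | lost => ∅
  | follow => {Sum.inl i}
  | vote b => {Sum.inr b}

theorem fate_eq_of_reachIn {U : Finset V} (hi : i ∉ U) {k : Fate}
    (h : ReachIn (action D) U (k.roots i) v) : fate D i v = k := by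
  induction h with
  | @base v hv h =>
    have hvi : v ≠ i := fun h => hi (h ▸ hv)
    cases k with
    | lost => simp [Fate.roots] at h
    | follow =>
      rw [fate_of_delegate hvi (by simpa [Fate.roots] using h), fate_self]
    | vote b => exact fate_of_direct hvi (by simpa [Fate.roots] using h)
  | @step v u hv h _ ih =>
    have hvi : v ≠ i := fun h => hi (h ▸ hv)
    rw [fate_of_delegate hvi h, ih]

theorem resolves_of_reachIn {U : Finset V} (hi : i ∉ U) {k : Fate}
    (h : ReachIn (action D) U (k.roots i) v) (b : Bool) :
    Resolves (withVote D i b) (k.ballot b) v := by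
  induction h with
  | @base v hv h =>
    have hvi : v ≠ i := fun h => hi (h ▸ hv)
    cases k with
    | lost => simp [Fate.roots] at h
    | follow =>
      obtain ⟨hu, h'⟩ := exists_of_action_eq_inl (i := i) (u := i) hvi
        (by simpa [Fate.roots] using h)
      exact .delegate (h' b) (.direct (Function.update_self _ _ _))
    | vote c =>
      refine .direct ?_
      rw [withVote_apply D hvi]
      have h : action D v = Sum.inr c := by simpa [Fate.roots] using h
      rw [action] at h
      rcases hx : D v with u | b <;> simp_all [Fate.ballot]
  | @step v u hv h _ ih =>
    have hvi : v ≠ i := fun h => hi (h ▸ hv)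
    obtain ⟨hu, h'⟩ := exists_of_action_eq_inl (i := i) hvi h
    exact .delegate (h' b) ih

theorem fate_ne_lost {b c : Bool} (h : Resolves (withVote D i b) c v) : fate D i v ≠ .lost := by
  induction h with
  | @direct v h =>
    by_cases hvi : v = i
    · rw [hvi, fate_self]; simp
    · rw [withVote_apply D hvi] at h
      rw [fate_of_direct hvi (show action D v = Sum.inr c by simp [action, h])]
      simp
  | @delegate v u h _ ih =>
    have hvi : v ≠ i := by
      rintro rfl
      simp [withVote] at h
    rw [withVote_apply D hvi] at h
    rwa [fate_of_delegate hvi (show action D v = Sum.inl u.1 by simp [action, h])]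

variable [Fintype V]

/-- The voters other than `i` of fate `k`. -/
def fateClass (i : V) (κ : V → Fate) (k : Fate) : Finset V :=
  Finset.univ.filter fun v => v ≠ i ∧ κ v = k

theorem mem_fateClass {κ : V → Fate} {k : Fate} : v ∈ fateClass i κ k ↔ v ≠ i ∧ κ v = k := by
  simp [fateClass]

theorem notMem_fateClass {κ : V → Fate} {k : Fate} : i ∉ fateClass i κ k := by
  simp [fateClass]

theorem reachIn_of_fate (hv : v ≠ i) (hl : fate D i v ≠ .lost) :
    ReachIn (action D) (fateClass i (fate D i) (fate D i v)) ((fate D i v).roots i) v := by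
  have : ∃ b, Resolves (withVote D i true) b v := by
    by_contra! h
    exact hl (by simp [fate, h])
  obtain ⟨b, hb⟩ := this
  clear hl
  induction hb with
  | @direct v h =>
    rw [withVote_apply D hv] at h
    have ha : action D v = Sum.inr b := by simp [action, h]
    refine .base (mem_fateClass.2 ⟨hv, rfl⟩) ?_
    rw [fate_of_direct hv ha, ha]
    simp [Fate.roots]
  | @delegate v u h _ ih =>
    rw [withVote_apply D hv] at h
    have ha : action D v = Sum.inl u.1 := by simp [action, h]
    have hf := fate_of_delegate hv ha
    by_cases hu : u.1 = i
    · refine .base (mem_fateClass.2 ⟨hv, rfl⟩) ?_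
      rw [hf, ha, hu, fate_self]
      simp [Fate.roots]
    · refine .step (mem_fateClass.2 ⟨hv, rfl⟩) ha ?_
      rw [hf]
      exact ih hu

theorem inducedVote_withVote (b : Bool) (v : V) :
    inducedVote (withVote D i b) v = (fate D i v).sign b := by
  by_cases hl : fate D i v = .lost
  · have h : ∀ c, ¬ Resolves (withVote D i b) c v := fun c h => fate_ne_lost h hl
    simp [inducedVote, h, hl, Fate.sign]
  by_cases hv : v = i
  · rw [hv, fate_self]
    exact inducedVote_eq_signOf (.direct (Function.update_self _ _ _))
  · have h := resolves_of_reachIn notMem_fateClass (reachIn_of_fate hv hl) b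
    rw [inducedVote_eq_signOf h]
    rcases hk : fate D i v with _ | _ | c <;> simp_all [Fate.sign, Fate.ballot]

/-- The indicator of the event that the voters assigned fate `k` by `κ` can have that fate, as far
as their own actions show: the `lost` ones delegate among themselves, and the others reach the
roots of `k` inside their class. It involves only the actions of these voters. -/
noncomputable def fateEvent (i : V) (κ : V → Fate) (k : Fate) (f : V → V ⊕ Bool) : ℚ :=
  match k with
  | .lost => ∏ v ∈ fateClass i κ .lost,
      if f v ∈ (fateClass i κ .lost).image Sum.inl then 1 else 0
  | k => allReach (fateClass i κ k) (k.roots i) f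

theorem fateEvent_dependsOn (κ : V → Fate) (k : Fate) :
    DependsOn (fateEvent i κ k) {v | κ v = k} := by
  have hsub : ∀ v ∈ fateClass i κ k, v ∈ {v | κ v = k} := fun v hv => (mem_fateClass.1 hv).2
  intro f g hfg
  cases k with
  | lost => exact Finset.prod_congr rfl fun v hv => by rw [hfg v (hsub v hv)]
  | follow => exact allReach_dependsOn _ _ fun v hv => hfg v (hsub v hv)
  | vote b => exact allReach_dependsOn _ _ fun v hv => hfg v (hsub v hv)

theorem fateEvent_fate (k : Fate) : fateEvent i (fate D i) k (action D) = 1 := by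
  have hreach : k ≠ .lost →
      allReach (fateClass i (fate D i) k) (k.roots i) (action D) = 1 := by
    intro hk
    refine if_pos fun v hv => ?_
    obtain ⟨hvi, rfl⟩ := mem_fateClass.1 hv
    exact reachIn_of_fate hvi hk
  cases k with
  | lost =>
    refine Finset.prod_eq_one fun v hv => if_pos ?_
    obtain ⟨hvi, hf⟩ := mem_fateClass.1 hv
    rcases ha : action D v with u | b
    · rw [fate_of_delegate hvi ha] at hf
      refine Finset.mem_image_of_mem _ (mem_fateClass.2 ⟨?_, hf⟩)
      rintro rfl
      simp [fate_self] at hf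
    · simp [fate_of_direct hvi ha] at hf
  | follow => exact hreach (by simp)
  | vote b => exact hreach (by simp)

theorem eq_fate_of_fateEvent {κ : V → Fate} (hi : κ i = .follow)
    (h : ∀ k, fateEvent i κ k (action D) ≠ 0) : κ = fate D i := by
  funext v
  by_cases hv : v = i
  · rw [hv, hi, fate_self]
  have hreach : ∀ k, κ v = k → allReach (fateClass i κ k) (k.roots i) (action D) ≠ 0 →
      k = fate D i v := by
    intro k hk hne
    have : ∀ v ∈ fateClass i κ k, ReachIn (action D) (fateClass i κ k) (k.roots i) v := by
      by_contra hn
      exact hne (if_neg hn)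
    exact (fate_eq_of_reachIn notMem_fateClass (this v (mem_fateClass.2 ⟨hv, hk⟩))).symm
  rcases hk : κ v with _ | _ | b
  · have hC : ∀ v ∈ fateClass i κ .lost, action D v ∈ (fateClass i κ .lost).image Sum.inl := by
      intro v hv
      by_contra hn
      exact h .lost (Finset.prod_eq_zero hv (if_neg hn))
    have hnot : ∀ c v, Resolves (withVote D i true) c v → v ∉ fateClass i κ .lost := by
      intro c v hr
      induction hr with
      | @direct v hd =>
        intro hv
        rw [withVote_apply D (mem_fateClass.1 hv).1] at hd
        have := hC v hv
        simp [action, hd] at this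
      | @delegate v u hd _ ih =>
        intro hv
        rw [withVote_apply D (mem_fateClass.1 hv).1] at hd
        have := hC v hv
        simp only [action, hd, Sum.map_inl, Finset.mem_image, Sum.inl.injEq] at this
        obtain ⟨u', hu', he⟩ := this
        exact ih (he ▸ hu')
    have h' : ∀ c, ¬ Resolves (withVote D i true) c v :=
      fun c hr => hnot c v hr (mem_fateClass.2 ⟨hv, hk⟩)
    simp [fate, h']
  · exact hreach _ hk (h .follow)
  · exact hreach _ hk (h (.vote b))

/-- The events for the four fates occur together exactly for the true assignment of fates. -/
theorem prod_fateEvent {κ : V → Fate} (hi : κ i = .follow) :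
    ∏ k, fateEvent i κ k (action D) = if κ = fate D i then 1 else 0 := by
  split_ifs with h
  · subst h
    exact Finset.prod_eq_one fun k _ => fateEvent_fate k
  · by_contra hne
    exact h (eq_fate_of_fateEvent hi fun k => Finset.prod_ne_zero_iff.1 hne k (Finset.mem_univ k))

/-- The probability that the voters other than `i` have the fates given by `κ`. -/
def fateProb (x y : ℚ) (i : V) (κ : V → Fate) : ℚ :=
  (((fateClass i κ .lost).card - 1 : ℕ) * y) ^ (fateClass i κ .lost).card *
    forestWeight y y (fateClass i κ .follow).card *
    forestWeight x y (fateClass i κ (.vote true)).card *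
    forestWeight x y (fateClass i κ (.vote false)).card

theorem expect_prod_fateEvent {x y : ℚ} (h : ((Fintype.card V - 1 : ℕ) : ℚ) * y + 2 * x = 1)
    (i : V) (κ : V → Fate) :
    expect (actionWeight x y) (fun f => ∏ k, fateEvent i κ k f) = fateProb x y i κ := by
  have hω := sum_actionWeight (V := V) h
  rw [expect_prod_fibers hω κ _ (fateEvent_dependsOn κ), Fate.prod_univ, fateProb]
  congr 1
  · congr 1
    · congr 1
      · change expect _ (fun f => ∏ v ∈ fateClass i κ .lost,
          if f v ∈ (fateClass i κ .lost).image Sum.inl then 1 else 0) = _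
        rw [expect_finset_prod hω _
          (fun _ a => if a ∈ (fateClass i κ .lost).image Sum.inl then 1 else 0)]
        rw [← Finset.prod_const]
        refine Finset.prod_congr rfl fun v hv => ?_
        simp only [mul_ite, mul_one, mul_zero, Finset.sum_ite_mem, Finset.univ_inter]
        rw [Finset.sum_image Sum.inl_injective.injOn]
        simp only [actionWeight, Sum.elim_inl]
        rw [← Finset.sum_erase_add _ _ hv,
          Finset.sum_congr rfl fun u hu => if_neg (Finset.ne_of_mem_erase hu)]
        simp [Finset.card_erase_of_mem hv]
      · refine expect_allReach h _ _ _ _ rfl ?_ ?_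
        · simp [Fate.roots, notMem_fateClass]
        · intro v hv
          simp [Fate.roots, actionWeight, (mem_fateClass.1 hv).1.symm]
    · refine expect_allReach h _ _ _ _ rfl ?_ ?_ <;> simp [Fate.roots, actionWeight]
  · refine expect_allReach h _ _ _ _ rfl ?_ ?_ <;> simp [Fate.roots, actionWeight]

/-- Voter `i` turns the outcome if the other voters have the fates given by `κ`. The weight of `i`
itself is counted with fate `follow`. -/
def decisive (w : V → ℕ) (q : ℚ) (κ : V → Fate) : Prop :=
  q * (fateWeight w κ .follow + fateWeight w κ (.vote true) + fateWeight w κ (.vote false) : ℕ) <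
      (fateWeight w κ .follow + fateWeight w κ (.vote true) : ℕ) ∧
    (fateWeight w κ (.vote true) : ℚ) ≤
      q * (fateWeight w κ .follow + fateWeight w κ (.vote true) + fateWeight w κ (.vote false) : ℕ)

instance (w : V → ℕ) (q : ℚ) (κ : V → Fate) : Decidable (decisive w q κ) :=
  inferInstanceAs (Decidable (_ ∧ _))

theorem game_difference (w : V → ℕ) (q : ℚ) (D : DelegationPartition G) (i : V) :
    (((weightedVotingGame w q (inducedVote (withVote D i true)) -
      weightedVotingGame w q (inducedVote (withVote D i false)) : ℤ) : ℚ) / 2) =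
      if decisive w q (fate D i) then 1 else 0 := by
  have hT : ∀ b, inducedVote (withVote D i b) = fun v => (fate D i v).sign b :=
    fun b => funext (inducedVote_withVote b)
  have h1 : ∀ b, (∑ v with (fate D i v).sign b ≠ 0, w v) = fateWeight w (fate D i) .follow +
      fateWeight w (fate D i) (.vote true) + fateWeight w (fate D i) (.vote false) := by
    intro b
    rw [sum_fate_filter w (fate D i) (fun k => k.sign b ≠ 0), Finset.sum_filter, Fate.sum_univ]
    cases b <;> simp [Fate.sign, signOf]
  have h2 : ∀ b, (∑ v with (fate D i v).sign b = 1, w v) =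
      (if b = true then fateWeight w (fate D i) .follow else 0) +
        fateWeight w (fate D i) (.vote true) := by
    intro b
    rw [sum_fate_filter w (fate D i) (fun k => k.sign b = 1), Finset.sum_filter, Fate.sum_univ]
    cases b <;> simp [Fate.sign, signOf]
  have hx : (fateWeight w (fate D i) (.vote true) : ℚ) ≤
      (fateWeight w (fate D i) .follow + fateWeight w (fate D i) (.vote true) : ℕ) := by
    exact_mod_cast Nat.le_add_left _ _
  simp only [weightedVotingGame, hT, h1, h2]
  simp only [if_true, Bool.false_eq_true, if_false, zero_add]
  by_cases hd : decisive w q (fate D i)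
  · rw [if_pos hd, if_pos hd.1, if_neg hd.2.not_gt]
    norm_num
  · rw [if_neg hd]
    by_cases ha : q * (fateWeight w (fate D i) .follow + fateWeight w (fate D i) (.vote true) +
        fateWeight w (fate D i) (.vote false) : ℕ) < (fateWeight w (fate D i) (.vote true) : ℚ)
    · rw [if_pos ha, if_pos (ha.trans_le hx)]
      norm_num
    · rw [if_neg ha, if_neg fun hb => hd ⟨hb, not_lt.1 ha⟩]
      norm_num

end Fates

/-! ### The measure as a sum over fate assignments -/

section Measure

theorem action_injective {V : Type*} :
    Function.Injective (action : DelegationPartition (completeDigraph V) → V → V ⊕ Bool) := by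
  intro D D' h
  funext v
  exact Sum.map_injective.2 ⟨Subtype.val_injective, Function.injective_id⟩ (congrFun h v)

variable {V : Type*} [Fintype V] [DecidableEq V]

theorem outDegree_completeDigraph (v : V) :
    outDegree (completeDigraph V) v = Fintype.card V - 1 := by
  have : outDegree (completeDigraph V) v = Fintype.card {u : V // u ≠ v} :=
    Fintype.card_congr (Equiv.subtypeEquivRight fun u => ne_comm)
  rw [this, Fintype.card_subtype_compl, Fintype.card_subtype_eq]

/-- The measure is the probability that `i` is decisive. It is a sum over exponentially many fate
assignments, but the summand depends only on the sizes of the fate classes and on their weights.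
-/
theorem ldMeasure_completeDigraph (pd : ℕ → ℚ) (hpd : pd 0 = 0) (w : V → ℕ) (q : ℚ) (i : V) :
    ldMeasure (completeDigraph V) pd (weightedVotingGame w q) i =
      ∑ κ : V → Fate with κ i = .follow,
        fateProb ((1 - pd (Fintype.card V - 1)) / 2)
          (pd (Fintype.card V - 1) / ((Fintype.card V - 1 : ℕ) : ℚ)) i κ *
        if decisive w q κ then 1 else 0 := by
  set n := Fintype.card V - 1 with hn
  set x := (1 - pd n) / 2 with hx
  set y := pd n / (n : ℚ) with hy
  have h : (n : ℚ) * y + 2 * x = 1 := by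
    have : (n : ℚ) * y = pd n := by
      -- A single voter has no possible delegate, and `pd 0 = 0` makes `pd 0 / 0 = 0` harmless.
      rcases eq_or_ne n 0 with h0 | h0
      · rw [h0, hpd]; simp
      · rw [hy]; field_simp
    rw [this, hx]; ring
  have hprob : ∀ D : DelegationPartition (completeDigraph V),
      partitionProb (completeDigraph V) pd D = ∏ v, actionWeight x y v (action D v) := by
    intro D
    refine Finset.prod_congr rfl fun v _ => ?_
    rw [action]
    rcases D v with ⟨u, hu⟩ | b
    · have hu' : u ≠ v := fun h => hu h.symm
      simp [actionProb, outDegree_completeDigraph, actionWeight, hu', hy, ← hn]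
    · simp [actionProb, outDegree_completeDigraph, actionWeight, hx, ← hn]
  -- Exactly one assignment of fates is the true one.
  have hterm : ∀ D : DelegationPartition (completeDigraph V),
      (if decisive w q (fate D i) then (1 : ℚ) else 0) =
        ∑ κ : V → Fate with κ i = .follow,
          (∏ k, fateEvent i κ k (action D)) * if decisive w q κ then 1 else 0 := by
    intro D
    rw [Finset.sum_eq_single_of_mem (fate D i) (by simp [fate_self])]
    · rw [prod_fateEvent (fate_self D i), if_pos rfl, one_mul]
    · intro κ hκ hne
      rw [prod_fateEvent (by simpa using hκ), if_neg hne, zero_mul]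
  have hsum : ldMeasure (completeDigraph V) pd (weightedVotingGame w q) i =
      expect (actionWeight x y) fun f => ∑ κ : V → Fate with κ i = .follow,
          (∏ k, fateEvent i κ k f) * if decisive w q κ then 1 else 0 := by
    -- Functions that are not actions of a partition let some voter delegate to itself: weight `0`.
    refine Fintype.sum_of_injective action action_injective _ _ ?_ ?_
    · intro f hf
      have : ∃ v, f v = Sum.inl v := by
        by_contra! hne
        refine hf ⟨fun v => match hfv : f v with
          | .inl u => Sum.inl ⟨u, fun huv => hne v (by rw [hfv, huv])⟩
          | .inr b => Sum.inr b, funext fun v => ?_⟩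
        simp only [action]
        split <;> simp_all
      obtain ⟨v, hv⟩ := this
      rw [Finset.prod_eq_zero (Finset.mem_univ v) (by simp [hv, actionWeight]), zero_mul]
    · intro D
      rw [hprob]
      exact congrArg _ ((game_difference w q D i).trans (hterm D))
  rw [hsum, expect_sum]
  refine Finset.sum_congr rfl fun κ _ => ?_
  rw [← expect_prod_fateEvent h]
  simp only [expect, ← mul_assoc, Finset.sum_mul]

end Measure

end LiquidDemocracy

/-! ### Reading off base-B digits -/

theorem sum_mul_pow_div_mod {B : ℕ} (E : ℕ) (c : ℕ → ℕ) (hc : ∀ j, c j < B) (k : ℕ) (hk : k < E) :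
    (∑ j ∈ Finset.range E, c j * B ^ j) / B ^ k % B = c k := by
  have hB : 0 < B := (Nat.zero_le _).trans_lt (hc 0)
  induction E generalizing c k with
  | zero => omega
  | succ E ih =>
    have h : ∑ j ∈ Finset.range (E + 1), c j * B ^ j =
        c 0 + B * ∑ j ∈ Finset.range E, c (j + 1) * B ^ j := by
      rw [Finset.sum_range_succ', Finset.mul_sum, pow_zero, mul_one, add_comm]
      congr 1
      exact Finset.sum_congr rfl fun j _ => by ring
    rw [h]
    cases k with
    | zero => simp [Nat.mod_eq_of_lt (hc 0)]
    | succ k =>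
      rw [pow_succ', ← Nat.div_div_eq_div_mul, Nat.add_mul_div_left _ _ hB,
        Nat.div_eq_of_lt (hc 0), zero_add]
      exact ih (fun j => c (j + 1)) (fun j => hc _) k (by omega)

/-- A sum of `g (e κ)` over a large index set can be computed from the number `∑ κ, B ^ e κ` by a
short sum: its digit at position `j` in base `B` is the number of `κ` with `e κ = j`, provided
that `B` exceeds the number of all `κ`. -/
theorem sum_digit_mul {ι : Type*} (K : Finset ι) (e : ι → ℕ) {B E : ℕ} (hB : K.card < B)
    (he : ∀ κ ∈ K, e κ < E) (g : ℕ → ℕ) :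
    ∑ j ∈ Finset.range E, (∑ κ ∈ K, B ^ e κ) / B ^ j % B * g j = ∑ κ ∈ K, g (e κ) := by
  have hmaps : ∀ κ ∈ K, e κ ∈ Finset.range E := fun κ hκ => Finset.mem_range.2 (he κ hκ)
  have hfib : ∀ h : ℕ → ℕ, ∑ κ ∈ K, h (e κ) =
      ∑ j ∈ Finset.range E, (K.filter fun κ => e κ = j).card * h j := by
    intro h
    rw [← Finset.sum_fiberwise_of_maps_to hmaps]
    refine Finset.sum_congr rfl fun j _ => ?_
    rw [Finset.sum_congr rfl fun κ hκ => by rw [(Finset.mem_filter.1 hκ).2], Finset.sum_const,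
      smul_eq_mul]
  rw [hfib g, hfib fun j => B ^ j]
  refine Finset.sum_congr rfl fun j hj => ?_
  rw [sum_mul_pow_div_mod E _
    (fun j => (Finset.card_le_card (Finset.filter_subset _ _)).trans_lt hB) j
    (Finset.mem_range.1 hj)]

/-! ### Arithmetic operations on terms -/

namespace RAM.Term

instance : Add Term := ⟨.bin .add⟩
instance : Sub Term := ⟨.bin .sub⟩
instance : Mul Term := ⟨.bin .mul⟩
instance : Div Term := ⟨.bin .div⟩

/-- The sum of `e` as the variable `x` runs through the numbers below `c`. -/
def sum (x : ℕ) (c e : Term) : Term := .fold .add 0 x c e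

/-- The product of `e` as the variable `x` runs through the numbers below `c`. -/
def prod (x : ℕ) (c e : Term) : Term := .fold .mul 1 x c e

/-- The power `b ^ e`, as a product over the dummy variable `9`, which must not occur in `b`. -/
def pow (b e : Term) : Term := prod 9 e b

def mod (e f : Term) : Term := e - f * (e / f)

/-- The term with value `1` if `e` is nonzero and `0` otherwise. -/
def sgn (e : Term) : Term := const 1 - (const 1 - e)

section Eval

variable (m env : ℕ → ℕ) (e f c : Term)

theorem eval_const (k : ℕ) : (const k).eval m env = k := rfl
theorem eval_var (x : ℕ) : (var x).eval m env = env x := rfl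
theorem eval_load : (load e).eval m env = m (e.eval m env) := rfl
theorem eval_add : (e + f).eval m env = e.eval m env + f.eval m env := rfl
theorem eval_sub : (e - f).eval m env = e.eval m env - f.eval m env := rfl
theorem eval_mul : (e * f).eval m env = e.eval m env * f.eval m env := rfl
theorem eval_div : (e / f).eval m env = e.eval m env / f.eval m env := rfl

theorem eval_sum (x : ℕ) : (sum x c e).eval m env =
    ∑ k ∈ Finset.range (c.eval m env), e.eval m (Function.update env x k) := by
  simp [sum, eval, BinOp.foldDown_add]

theorem eval_prod (x : ℕ) : (prod x c e).eval m env =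
    ∏ k ∈ Finset.range (c.eval m env), e.eval m (Function.update env x k) := by
  simp [prod, eval, BinOp.foldDown_mul]

theorem eval_mod : (mod e f).eval m env = e.eval m env % f.eval m env := by
  rw [mod, eval_sub, eval_mul, eval_div]
  exact (Nat.mod_eq_sub _ _).symm

theorem eval_sgn : (sgn e).eval m env = if e.eval m env = 0 then 0 else 1 := by
  simp only [sgn, eval_sub, eval_const]
  split_ifs <;> omega

variable {m env e}

theorem eval_pow {b : Term} (hb : ∀ k, b.eval m (Function.update env 9 k) = b.eval m env) :
    (pow b e).eval m env = b.eval m env ^ e.eval m env := by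
  simp [pow, eval_prod, hb]

end Eval

end RAM.Term

namespace LiquidDemocracy

open RAM RAM.Term

/-! ### The terms for numerator and denominator

Variables `0` to `5` are the input registers: the number of voters, the voter `i`, and the
numerators and denominators of the quota and of the delegation probability. The bound variables are
`6` and `7` for voters, `8` for the code of a profile, and `9` for counting in powers. -/

/-- The value of `forestWeight` for natural numbers; the truncated subtraction is exact
(`cast_forestNum`). -/
def forestNum (r y m : ℕ) : ℕ := (r + m * y) ^ m - m * y * (r + m * y) ^ (m - 1)

theorem cast_forestNum (r y m : ℕ) : (forestNum r y m : ℚ) = forestWeight r y m := by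
  have h : m * y * (r + m * y) ^ (m - 1) ≤ (r + m * y) ^ m := by
    cases m with
    | zero => simp
    | succ m =>
      rw [Nat.add_sub_cancel, pow_succ']
      exact Nat.mul_le_mul_right _ (Nat.le_add_left _ _)
  rw [forestNum, Nat.cast_sub h, forestWeight]
  push_cast
  rfl

/-- The numerator of `fateProb` for the delegation probability `P / Q` and `n` voters, of which
`s` follow `i` (not counting `i`) and `a` and `b` receive a direct vote for and against from
others; the common denominator is `(2 * Q * (n - 1)) ^ (n - 1)`. -/
def profileWeight (n P Q s a b : ℕ) : ℕ :=
  ((n - 1 - s - a - b - 1) * (2 * P)) ^ (n - 1 - s - a - b) * forestNum (2 * P) (2 * P) s *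
    forestNum ((Q - P) * (n - 1)) (2 * P) a * forestNum ((Q - P) * (n - 1)) (2 * P) b

/-- The indicator of `decisive` in natural numbers, for the quota `q₁ / q₂` and the weights `x`,
`y`, `z` of the fates `follow`, `vote true` and `vote false`; truncated subtraction expresses the
comparisons. -/
def decisiveNum (q₁ q₂ x y z : ℕ) : ℕ :=
  (if (x + y) * q₂ - (x + y + z) * q₁ = 0 then 0 else 1) * (1 - (y * q₂ - (x + y + z) * q₁))

/-- The radix used for coding profiles: larger than the number of voters and than their total
weight. -/
def radix (m : ℕ → ℕ) (n : ℕ) : ℕ := 1 + n + ∑ v ∈ Finset.range n, m v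

def radixTerm : Term := const 1 + var 0 + sum 7 (var 0) (load (var 7))

theorem eval_radixTerm (m env : ℕ → ℕ) : radixTerm.eval m env = radix m (env 0) := by
  simp [radixTerm, eval_add, eval_const, eval_var, eval_sum, eval_load, radix]

/-- The base `4 ^ n + 1`, which exceeds the number of all assignments of fates. -/
def baseTerm : Term := pow (const 4) (var 0) + const 1

theorem eval_baseTerm (m env : ℕ → ℕ) : baseTerm.eval m env = 4 ^ env 0 + 1 := by
  rw [baseTerm, eval_add, eval_pow (fun _ => rfl)]
  rfl

def basePow (e : Term) : Term := pow baseTerm e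

theorem eval_basePow (m env : ℕ → ℕ) (e : Term) :
    (basePow e).eval m env = (4 ^ env 0 + 1) ^ e.eval m env := by
  rw [basePow, eval_pow (fun k => by simp [eval_baseTerm]), eval_baseTerm]

/-- The factor of a voter of weight `w` in the generating number: the sum of `B` to the codes of
its possible fates. Here `d` is `0` for voter `i`, whose only fate is `follow` and who is not
counted among the followers, and `1` for the others. -/
def voterFactor (R B w d : ℕ) : ℕ :=
  B ^ (d + R * R * R * w) +
    d * (1 + B ^ (R + R * R * R * R * w) + B ^ (R * R + R * R * R * R * R * w))

/-- The term with value `0` if the running voter `6` is the voter `i` (variable `1`), and `1`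
otherwise. -/
def differTerm : Term := sgn ((var 6 - var 1) + (var 1 - var 6))

theorem eval_differTerm (m env : ℕ → ℕ) :
    differTerm.eval m env = if env 6 = env 1 then 0 else 1 := by
  simp only [differTerm, eval_sgn, eval_add, eval_sub, eval_var]
  refine if_congr ?_ rfl rfl
  omega

def voterTerm : Term :=
  basePow (differTerm + radixTerm * radixTerm * radixTerm * load (var 6)) +
    differTerm * (const 1 +
      basePow (radixTerm + radixTerm * radixTerm * radixTerm * radixTerm * load (var 6)) +
      basePow (radixTerm * radixTerm +
        radixTerm * radixTerm * radixTerm * radixTerm * radixTerm * load (var 6)))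

/-- The generating number: the sum of `B ^ code` over all assignments of fates, as a product over
the voters. -/
def generatingTerm : Term := prod 6 (var 0) voterTerm

theorem eval_generatingTerm (m env : ℕ → ℕ) :
    generatingTerm.eval m env = ∏ v ∈ Finset.range (env 0),
      voterFactor (radix m (env 0)) (4 ^ env 0 + 1) (m v) (if v = env 1 then 0 else 1) := by
  simp [generatingTerm, voterTerm, eval_prod, eval_var, eval_add, eval_mul, eval_basePow,
    eval_differTerm, eval_radixTerm, eval_load, eval_const, voterFactor]

def quotTerm : ℕ → Term
  | 0 => var 8
  | k + 1 => quotTerm k / radixTerm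

/-- The coordinate number `k` of the profile coded by variable `8`. -/
def coordTerm (k : ℕ) : Term := mod (quotTerm k) radixTerm

/-- The digit number `k` of `j` in base `R`. -/
def coord (R j k : ℕ) : ℕ := (· / R)^[k] j % R

theorem eval_coordTerm (m env : ℕ → ℕ) (k : ℕ) :
    (coordTerm k).eval m env = coord (radix m (env 0)) (env 8) k := by
  have h : (quotTerm k).eval m env = (· / radix m (env 0))^[k] (env 8) := by
    induction k with
    | zero => rfl
    | succ k ih => rw [quotTerm, eval_div, ih, eval_radixTerm, Function.iterate_succ_apply']
  rw [coordTerm, eval_mod, h, eval_radixTerm, coord]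

def forestTerm (r y c : Term) : Term := pow (r + c * y) c - c * y * pow (r + c * y) (c - const 1)

theorem eval_forestTerm {m env : ℕ → ℕ} {r y c : Term}
    (hr : ∀ k, r.eval m (Function.update env 9 k) = r.eval m env)
    (hy : ∀ k, y.eval m (Function.update env 9 k) = y.eval m env)
    (hc : ∀ k, c.eval m (Function.update env 9 k) = c.eval m env) :
    (forestTerm r y c).eval m env =
      forestNum (r.eval m env) (y.eval m env) (c.eval m env) := by
  have h : ∀ k, (r + c * y).eval m (Function.update env 9 k) = (r + c * y).eval m env :=
    fun k => by simp only [eval_add, eval_mul, hr, hy, hc]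
  simp only [forestTerm, eval_sub, eval_mul, eval_pow h, eval_add, eval_const, forestNum]

def lostTerm : Term := var 0 - const 1 - coordTerm 0 - coordTerm 1 - coordTerm 2

def profileTerm : Term :=
  pow ((lostTerm - const 1) * (const 2 * var 4)) lostTerm *
    forestTerm (const 2 * var 4) (const 2 * var 4) (coordTerm 0) *
    forestTerm ((var 5 - var 4) * (var 0 - const 1)) (const 2 * var 4) (coordTerm 1) *
    forestTerm ((var 5 - var 4) * (var 0 - const 1)) (const 2 * var 4) (coordTerm 2)

theorem eval_profileTerm (m env : ℕ → ℕ) :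
    profileTerm.eval m env = profileWeight (env 0) (env 4) (env 5)
      (coord (radix m (env 0)) (env 8) 0) (coord (radix m (env 0)) (env 8) 1)
      (coord (radix m (env 0)) (env 8) 2) := by
  have h1 : ∀ k, ((lostTerm - const 1) * (const 2 * var 4)).eval m (Function.update env 9 k) =
      ((lostTerm - const 1) * (const 2 * var 4)).eval m env := fun k => by
    simp [lostTerm, eval_mul, eval_sub, eval_coordTerm, eval_var, eval_const]
  have h2 : ∀ k, (const 2 * var 4).eval m (Function.update env 9 k) =
      (const 2 * var 4).eval m env := fun k => by simp [eval_mul, eval_var, eval_const]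
  have h3 : ∀ k, ((var 5 - var 4) * (var 0 - const 1)).eval m (Function.update env 9 k) =
      ((var 5 - var 4) * (var 0 - const 1)).eval m env := fun k => by
    simp [eval_mul, eval_sub, eval_var, eval_const]
  have h4 : ∀ l k, (coordTerm l).eval m (Function.update env 9 k) = (coordTerm l).eval m env :=
    fun l k => by simp [eval_coordTerm]
  rw [profileTerm, eval_mul, eval_mul, eval_mul, eval_pow h1, eval_forestTerm h2 h2 (h4 0),
    eval_forestTerm h3 h2 (h4 1), eval_forestTerm h3 h2 (h4 2)]
  simp only [lostTerm, eval_mul, eval_sub, eval_coordTerm, eval_var, eval_const, profileWeight]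

def decisiveTerm : Term :=
  sgn ((coordTerm 3 + coordTerm 4) * var 3 -
      (coordTerm 3 + coordTerm 4 + coordTerm 5) * var 2) *
    (const 1 - (coordTerm 4 * var 3 - (coordTerm 3 + coordTerm 4 + coordTerm 5) * var 2))

/-- The numerator of the measure: a sum over all codes of profiles, each weighted by the number of
fate assignments with that profile. -/
def numeratorTerm : Term :=
  sum 8 (radixTerm * radixTerm * radixTerm * radixTerm * radixTerm * radixTerm)
    (mod (generatingTerm / basePow (var 8)) baseTerm * (profileTerm * decisiveTerm))

def denominatorTerm : Term := pow (const 2 * var 5 * (var 0 - const 1)) (var 0 - const 1)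

theorem eval_denominatorTerm (m env : ℕ → ℕ) :
    denominatorTerm.eval m env = (2 * env 5 * (env 0 - 1)) ^ (env 0 - 1) := by
  rw [denominatorTerm, eval_pow (fun k => by simp [eval_mul, eval_sub, eval_var, eval_const])]
  rfl

/-- The contribution of one assignment of fates with profile `c`: three class sizes and three
class weights. -/
def profileGain (n q₁ q₂ P Q : ℕ) (c : ℕ → ℕ) : ℕ :=
  profileWeight n P Q (c 0) (c 1) (c 2) * decisiveNum q₁ q₂ (c 3) (c 4) (c 5)

theorem eval_numeratorTerm (m env : ℕ → ℕ) :
    numeratorTerm.eval m env = ∑ j ∈ Finset.range (radix m (env 0) ^ 6),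
      (∏ v ∈ Finset.range (env 0),
        voterFactor (radix m (env 0)) (4 ^ env 0 + 1) (m v) (if v = env 1 then 0 else 1)) /
          (4 ^ env 0 + 1) ^ j % (4 ^ env 0 + 1) *
        profileGain (env 0) (env 2) (env 3) (env 4) (env 5) (coord (radix m (env 0)) j) := by
  have hR : ∀ R : ℕ, R * R * R * R * R * R = R ^ 6 := fun R => by ring
  simp only [numeratorTerm, eval_sum, eval_mul, eval_mod, eval_div, eval_generatingTerm,
    eval_basePow, eval_baseTerm, eval_profileTerm, decisiveTerm, eval_sgn, eval_sub, eval_add,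
    eval_coordTerm, eval_radixTerm, eval_var, eval_const, hR, profileGain, decisiveNum]
  simp

theorem numeratorTerm_feasible : numeratorTerm.feasible [0, 1] = true := by decide

theorem denominatorTerm_feasible : denominatorTerm.feasible [0, 1] = true := by decide

end LiquidDemocracy

namespace LiquidDemocracy

open RAM RAM.Term

/-! ### Correctness of the terms -/

theorem coord_zero {R s : ℕ} (t : ℕ) (h : s < R) : coord R (s + R * t) 0 = s := by
  simp [coord, Nat.mod_eq_of_lt h]

theorem coord_succ {R s : ℕ} (t k : ℕ) (h : s < R) :
    coord R (s + R * t) (k + 1) = coord R t k := by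
  rw [coord, Function.iterate_succ_apply, coord, Nat.add_mul_div_left _ _ (by omega),
    Nat.div_eq_of_lt h, zero_add]

/-- The code of a profile: the number with the six given digits in base `R`, lowest digit first.
-/
def horner (R s a b x y z : ℕ) : ℕ := s + R * (a + R * (b + R * (x + R * (y + R * z))))

theorem horner_lt {R s a b x y z : ℕ} (hs : s < R) (ha : a < R) (hb : b < R) (hx : x < R)
    (hy : y < R) (hz : z < R) : horner R s a b x y z < R ^ 6 := by
  have step : ∀ {u t k : ℕ}, u < R → t < R ^ k → u + R * t < R ^ (k + 1) := by
    intro u t k hu ht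
    calc u + R * t < R * (t + 1) := by rw [mul_add, mul_one]; omega
      _ ≤ R * R ^ k := Nat.mul_le_mul_left _ ht
      _ = R ^ (k + 1) := (pow_succ' R k).symm
  exact step hs (step ha (step hb (step hx (step hy (by simpa using hz : z < R ^ 1)))))

theorem profileGain_horner (n q₁ q₂ P Q : ℕ) {R s a b x y z : ℕ} (hs : s < R) (ha : a < R)
    (hb : b < R) (hx : x < R) (hy : y < R) (hz : z < R) :
    profileGain n q₁ q₂ P Q (coord R (horner R s a b x y z)) =
      profileWeight n P Q s a b * decisiveNum q₁ q₂ x y z := by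
  have hz' : coord R z 0 = z := by simpa using coord_zero 0 hz
  simp only [profileGain, horner, coord_succ, coord_zero, hs, ha, hb, hx, hy, hz']

theorem cast_decisiveNum {V : Type*} [Fintype V] (w : V → ℕ) {q : ℚ} (hq : 0 ≤ q) (κ : V → Fate) :
    (decisiveNum q.num.toNat q.den (fateWeight w κ .follow) (fateWeight w κ (.vote true))
      (fateWeight w κ (.vote false)) : ℚ) = if decisive w q κ then 1 else 0 := by
  have hden : (0 : ℚ) < q.den := by exact_mod_cast q.den_pos
  have hqe : q = (q.num.toNat : ℚ) / (q.den : ℚ) := by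
    have h : ((q.num.toNat : ℤ) : ℚ) = q.num := by
      rw [Int.toNat_of_nonneg (Rat.num_nonneg.2 hq)]
    rw [← Int.cast_natCast q.num.toNat, h, Rat.num_div_den]
  have hiff : decisive w q κ ↔ _ ∧ _ := Iff.rfl
  rw [decisiveNum, if_congr hiff rfl rfl]
  set x := fateWeight w κ .follow
  set y := fateWeight w κ (.vote true)
  set z := fateWeight w κ (.vote false)
  have h1 : q * ((x + y + z : ℕ) : ℚ) < ((x + y : ℕ) : ℚ) ↔
      (x + y) * q.den - (x + y + z) * q.num.toNat ≠ 0 := by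
    rw [Nat.sub_ne_zero_iff_lt, ← Nat.cast_lt (α := ℚ)]
    conv_lhs => rw [hqe, div_mul_eq_mul_div, div_lt_iff₀ hden]
    push_cast
    rw [mul_comm (q.num.toNat : ℚ)]
  have h2 : (y : ℚ) ≤ q * ((x + y + z : ℕ) : ℚ) ↔
      y * q.den - (x + y + z) * q.num.toNat = 0 := by
    rw [Nat.sub_eq_zero_iff_le, ← Nat.cast_le (α := ℚ)]
    conv_lhs => rw [hqe, div_mul_eq_mul_div, le_div_iff₀ hden]
    push_cast
    rw [mul_comm (q.num.toNat : ℚ)]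
  simp only [h1, h2]
  generalize (x + y) * q.den - (x + y + z) * q.num.toNat = u
  generalize y * q.den - (x + y + z) * q.num.toNat = t
  rcases u with _ | u <;> rcases t with _ | t <;> simp

section Profiles

variable {V : Type*} [Fintype V] [DecidableEq V]

/-- The share of voter `v` in the code of the profile, depending on its fate. -/
def fateCode (R : ℕ) (w : V → ℕ) (i v : V) : Fate → ℕ
  | .lost => 0
  | .follow => (if v = i then 0 else 1) + R * R * R * w v
  | .vote true => R + R * R * R * R * w v
  | .vote false => R * R + R * R * R * R * R * w v

theorem sum_fateCode (R : ℕ) (w : V → ℕ) {i : V} {κ : V → Fate} (hi : κ i = .follow) :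
    ∑ v, fateCode R w i v (κ v) =
      horner R (fateClass i κ .follow).card (fateClass i κ (.vote true)).card
        (fateClass i κ (.vote false)).card (fateWeight w κ .follow) (fateWeight w κ (.vote true))
        (fateWeight w κ (.vote false)) := by
  simp only [horner, fateClass, fateWeight, Finset.card_filter, Finset.sum_filter, Finset.mul_sum,
    ← Finset.sum_add_distrib]
  refine Finset.sum_congr rfl fun v _ => ?_
  by_cases hv : v = i
  · subst hv
    simp [hi, fateCode]
    ring
  · rcases κ v with _ | _ | _ | _ <;> simp [hv, fateCode] <;> ring

theorem prod_voterFactor (R B : ℕ) (w : V → ℕ) (i : V) :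
    ∏ v, voterFactor R B (w v) (if v = i then 0 else 1) =
      ∑ κ : V → Fate with κ i = .follow, B ^ ∑ v, fateCode R w i v (κ v) := by
  have h1 : ∀ v, voterFactor R B (w v) (if v = i then 0 else 1) =
      ∑ k ∈ if v = i then {Fate.follow} else Finset.univ, B ^ fateCode R w i v k := by
    intro v
    split_ifs with hv
    · simp [hv, voterFactor, fateCode]
    · simp only [voterFactor, Fate.sum_univ, fateCode, hv, if_false]
      ring
  have h2 : (Finset.univ.filter fun κ : V → Fate => κ i = .follow) =
      Fintype.piFinset fun v => if v = i then {Fate.follow} else Finset.univ := by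
    ext κ
    simp only [Finset.mem_filter, Finset.mem_univ, true_and, Fintype.mem_piFinset]
    constructor
    · intro h v
      split_ifs with hv
      · simp [hv, h]
      · simp
    · intro h
      simpa using h i
  rw [Finset.prod_congr rfl fun v _ => h1 v, Finset.prod_univ_sum, h2]
  exact Finset.sum_congr rfl fun κ _ => Finset.prod_pow_eq_pow_sum _ _ _

theorem sum_card_fateClass {i : V} (κ : V → Fate) :
    (fateClass i κ .lost).card + (fateClass i κ .follow).card +
      (fateClass i κ (.vote true)).card + (fateClass i κ (.vote false)).card =
      Fintype.card V - 1 := by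
  have h : ∑ k, (fateClass i κ k).card = (Finset.univ.erase i).card := by
    rw [Finset.card_eq_sum_card_fiberwise (f := κ) (t := Finset.univ) (by simp)]
    refine Finset.sum_congr rfl fun k _ => congrArg _ ?_
    ext v
    simp [fateClass]
  rw [Fate.sum_univ, Finset.card_erase_of_mem (Finset.mem_univ i), Finset.card_univ] at h
  exact h

theorem fateProb_mul_pow (x y d : ℚ) (i : V) (κ : V → Fate) :
    fateProb x y i κ * d ^ (Fintype.card V - 1) = fateProb (x * d) (y * d) i κ := by
  rw [← sum_card_fateClass (i := i) κ, fateProb, fateProb, ← forestWeight_mul_pow,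
    ← forestWeight_mul_pow, ← forestWeight_mul_pow]
  simp only [mul_pow, pow_add]
  ring

theorem cast_profileWeight (P Q : ℕ) (i : V) (κ : V → Fate) :
    (profileWeight (Fintype.card V) P Q (fateClass i κ .follow).card
      (fateClass i κ (.vote true)).card (fateClass i κ (.vote false)).card : ℚ) =
      fateProb (((Q - P) * (Fintype.card V - 1) : ℕ) : ℚ) ((2 * P : ℕ) : ℚ) i κ := by
  have h : Fintype.card V - 1 - (fateClass i κ .follow).card - (fateClass i κ (.vote true)).card -
      (fateClass i κ (.vote false)).card = (fateClass i κ .lost).card := by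
    have := sum_card_fateClass (i := i) κ
    omega
  rw [profileWeight, h]
  simp only [Nat.cast_mul (_ * _), Nat.cast_mul (_ ^ _), cast_forestNum, Nat.cast_pow, fateProb,
    Nat.cast_mul ((fateClass i κ .lost).card - 1)]

end Profiles

section Input

variable {n : ℕ} (w : Fin n → ℕ) (q p : ℚ) (i : Fin n)

theorem inputState_mem (v : Fin n) : (inputState n w q p i).mem v = w v := by
  simp [inputState]

theorem radix_inputState : radix (inputState n w q p i).mem n = 1 + n + ∑ v, w v := by
  rw [radix, Finset.sum_range]
  simp only [inputState_mem]

theorem eval_numeratorTerm_inputState (hq : 0 ≤ q) :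
    ((numeratorTerm.eval (inputState n w q p i).mem (inputState n w q p i).reg : ℕ) : ℚ) =
      ∑ κ : Fin n → Fate with κ i = .follow,
        fateProb (((p.den - p.num.toNat) * (n - 1) : ℕ) : ℚ) ((2 * p.num.toNat : ℕ) : ℚ) i κ *
          if decisive w q κ then 1 else 0 := by
  set R := 1 + n + ∑ v, w v with hR
  have h0 : (inputState n w q p i).reg 0 = n := rfl
  have h1 : (inputState n w q p i).reg 1 = i := rfl
  have h2 : (inputState n w q p i).reg 2 = q.num.toNat := rfl
  have h3 : (inputState n w q p i).reg 3 = q.den := rfl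
  have h4 : (inputState n w q p i).reg 4 = p.num.toNat := rfl
  have h5 : (inputState n w q p i).reg 5 = p.den := rfl
  have hcard : ∀ (κ : Fin n → Fate) k, (fateClass i κ k).card < R := fun κ k => by
    have := (fateClass i κ k).card_le_univ
    rw [Fintype.card_fin] at this
    omega
  have hweight : ∀ (κ : Fin n → Fate) k, fateWeight w κ k < R := fun κ k => by
    have : fateWeight w κ k ≤ ∑ v, w v :=
      Finset.sum_le_sum_of_subset (Finset.filter_subset _ _)
    omega
  rw [eval_numeratorTerm, h0, h1, h2, h3, h4, h5, radix_inputState, ← hR, Finset.prod_range]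
  simp only [inputState_mem, Fin.val_inj]
  rw [prod_voterFactor, sum_digit_mul, Nat.cast_sum]
  · refine Finset.sum_congr rfl fun κ hκ => ?_
    rw [sum_fateCode R w (Finset.mem_filter.1 hκ).2,
      profileGain_horner _ _ _ _ _ (hcard _ _) (hcard _ _) (hcard _ _) (hweight _ _)
        (hweight _ _) (hweight _ _), Nat.cast_mul, cast_decisiveNum w hq]
    have := cast_profileWeight p.num.toNat p.den i κ
    rw [Fintype.card_fin] at this
    rw [this]
  · refine Nat.lt_succ_of_le ((Finset.card_filter_le _ _).trans ?_)
    rw [Finset.card_univ, Fintype.card_fun, Fintype.card_fin]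
    exact le_rfl
  · intro κ hκ
    rw [sum_fateCode R w (Finset.mem_filter.1 hκ).2]
    exact horner_lt (hcard _ _) (hcard _ _) (hcard _ _) (hweight _ _) (hweight _ _) (hweight _ _)

/-! ### Bounds on the input -/

theorem inputState_mem_le (a : ℕ) : (inputState n w q p i).mem a ≤ inputSize n w q p := by
  simp only [inputState, inputSize]
  split_ifs with h
  · have := Finset.le_sup (f := w) (Finset.mem_univ ⟨a, h⟩)
    omega
  · exact Nat.zero_le _

theorem inputState_reg_le {x : ℕ} (hx : x ∈ [0, 1]) :
    (inputState n w q p i).reg x ≤ inputSize n w q p := by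
  have hi := i.2
  have h : x = 0 ∨ x = 1 := by simpa using hx
  rcases h with rfl | rfl
  · change n ≤ _
    rw [inputSize]; omega
  · change i.1 ≤ _
    rw [inputSize]; omega

theorem inputState_reg_eq_zero {x : ℕ} (hx : 6 ≤ x) : (inputState n w q p i).reg x = 0 :=
  List.getD_eq_default _ _ hx

theorem numCost_inputState_reg_le (x : ℕ) :
    numCost ((inputState n w q p i).reg x) ≤ inputSize n w q p + 1 := by
  rcases Nat.lt_or_ge x 6 with hx | hx
  · have h01 : ∀ y ∈ [0, 1], numCost ((inputState n w q p i).reg y) ≤ inputSize n w q p + 1 :=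
      fun y hy => (numCost_le_succ _).trans (Nat.succ_le_succ (inputState_reg_le w q p i hy))
    refine Nat.le_of_lt_succ ?_
    interval_cases x
    · exact Nat.lt_succ_of_le (h01 0 (by simp))
    · exact Nat.lt_succ_of_le (h01 1 (by simp))
    · change numCost q.num.toNat < _
      rw [numCost, inputSize]; omega
    · change numCost q.den < _
      rw [numCost, inputSize]; omega
    · change numCost p.num.toNat < _
      rw [numCost, inputSize]; omega
    · change numCost p.den < _
      rw [numCost, inputSize]; omega
  · rw [inputState_reg_eq_zero w q p i hx]
    simp [numCost]

end Input

end LiquidDemocracy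

theorem theorem4 :
    ∃ (prog : RAM.Program) (bound : Polynomial ℕ),
      ∀ (n : ℕ) (w : Fin n → ℕ) (q : ℚ) (pd : ℕ → ℚ) (i : Fin n),
        (∀ v, 0 < w v) → 1 / 2 ≤ q → q ≤ 1 →
        (∀ d, 0 ≤ pd d ∧ pd d ≤ 1) → pd 0 = 0 →
        ∃ (s : RAM.State) (t : ℕ),
          RAM.Exec prog (LiquidDemocracy.inputState n w q (pd (n - 1)) i) s t ∧
          t ≤ bound.eval (LiquidDemocracy.inputSize n w q (pd (n - 1))) ∧
          s.reg 1 ≠ 0 ∧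
          (s.reg 0 : ℚ) / (s.reg 1 : ℚ) =
            LiquidDemocracy.ldMeasure (LiquidDemocracy.completeDigraph (Fin n)) pd
              (LiquidDemocracy.weightedVotingGame w q) i := by
  obtain ⟨prog, bound, hprog⟩ := RAM.exists_program 6 [0, 1] LiquidDemocracy.numeratorTerm
    LiquidDemocracy.denominatorTerm LiquidDemocracy.numeratorTerm_feasible
    LiquidDemocracy.denominatorTerm_feasible
  refine ⟨prog, bound, fun n w q pd i _ hq _ hpd hpd0 => ?_⟩
  set p := pd (n - 1) with hp
  obtain ⟨s, t, hexec, ht, hnum, hden⟩ := hprog (LiquidDemocracy.inputSize n w q p)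
    (LiquidDemocracy.inputState n w q p i) (LiquidDemocracy.inputState_mem_le w q p i)
    (fun x => LiquidDemocracy.inputState_reg_le w q p i)
    (LiquidDemocracy.numCost_inputState_reg_le w q p i)
    (fun x => LiquidDemocracy.inputState_reg_eq_zero w q p i)
  have hden' : s.reg 1 = (2 * p.den * (n - 1)) ^ (n - 1) := by
    rw [hden, LiquidDemocracy.eval_denominatorTerm]; rfl
  have hne : s.reg 1 ≠ 0 := by
    rw [hden']
    -- For a single voter the denominator is `0 ^ 0 = 1`.
    rcases Nat.eq_zero_or_pos (n - 1) with h | h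
    · simp [h]
    · have := p.den_pos
      positivity
  refine ⟨s, t, hexec, ht, hne, ?_⟩
  rw [div_eq_iff (by exact_mod_cast hne), hnum,
    LiquidDemocracy.eval_numeratorTerm_inputState w q p i (by linarith),
    LiquidDemocracy.ldMeasure_completeDigraph pd hpd0, Finset.sum_mul, hden', Nat.cast_pow]
  have hpd' : (p.den : ℚ) ≠ 0 := by exact_mod_cast p.den_ne_zero
  have hpnum : p * p.den = p.num.toNat := by
    have h : ((p.num.toNat : ℤ) : ℚ) = p.num := by
      rw [Int.toNat_of_nonneg (Rat.num_nonneg.2 (hpd _).1)]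
    rw [← Int.cast_natCast p.num.toNat, h, Rat.mul_den_eq_num]
  have hle : p.num.toNat ≤ p.den := by
    have h : (p.num.toNat : ℚ) ≤ p.den := by
      rw [← hpnum]
      exact mul_le_of_le_one_left (Nat.cast_nonneg _) (hpd _).2
    exact_mod_cast h
  have hx : (1 - p) / 2 * ((2 * p.den * (n - 1) : ℕ) : ℚ) =
      (((p.den - p.num.toNat) * (n - 1) : ℕ) : ℚ) := by
    rw [Nat.cast_mul _ (n - 1), Nat.cast_mul _ (n - 1), Nat.cast_sub hle, ← hpnum]
    push_cast
    ring
  have hy : p / ((n - 1 : ℕ) : ℚ) * ((2 * p.den * (n - 1) : ℕ) : ℚ) =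
      ((2 * p.num.toNat : ℕ) : ℚ) := by
    rw [Nat.cast_mul _ (n - 1), Nat.cast_mul 2 p.num.toNat, ← hpnum]
    rcases Nat.eq_zero_or_pos (n - 1) with h | h
    -- A single voter: both sides vanish since `pd 0 = 0`.
    · have hp0 : p = 0 := by rw [hp, h, hpd0]
      rw [hp0]; simp
    · have : ((n - 1 : ℕ) : ℚ) ≠ 0 := by exact_mod_cast h.ne'
      push_cast
      field_simp
  refine Finset.sum_congr rfl fun κ _ => ?_
  have h := LiquidDemocracy.fateProb_mul_pow ((1 - p) / 2) (p / ((n - 1 : ℕ) : ℚ))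
    ((2 * p.den * (n - 1) : ℕ) : ℚ) i κ
  rw [hx, hy, Fintype.card_fin] at h
  rw [← h, Fintype.card_fin, ← hp]
  ring
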